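/- Let $k$ be a field of arbitrary characteristic, $V$ a finite-dimensional $k$-vector space, and $G$ a finite group acting linearly on $V$; write ${}^g v$ for the action of $g\in G$ on $v \in V$, extended to an action of $G$ by algebra automorphisms on the symmetric algebra $S(V)$. Let $\lambda : kG\otimes V\to kG$ and $\kappa: V\otimes V\to kG$ be $k$-linear maps, written $\lambda(x,v)$ and $\kappa(v,w)$, with $\kappa$ alternating ($\kappa(v,v)=0$ for all $v$). Write $\lambda(h,v)=\sum_{g\in G}\lambda_g(h,v)\,g$ and $\kappa(u,v)=\sum_{g\in G}\kappa_g(u,v)\,g$ with $\lambda_g(h,v),\kappa_g(u,v)\in k$. Let $\mathcal{H}_{\lambda,\kappa}$ be the associative unital $k$-algebra generated by the vector space $V$ and the group algebra $kG$ (with the linear relations of $V$ and the relations of $kG$) subject to $$vw-wv=\kappa(v,w),\qquad gv-{}^g v\,g=\lambda(g,v)\qquad (v,w\in V,\ g\in G).$$ Filter it by degree with $\deg v=1$ for $v \in V$ and $\deg g=0$ for $g \in G$: the $n$-th level $F_n$ is the span of the products of elements of $V$ and $G$ with at most $n$ factors from $V$. Put $\mathrm{gr}\,\mathcal{H}_{\lambda,\kappa}=\bigoplus_{n\ge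 0}F_n/F_{n-1}$, $F_{-1}=0$. Let $S(V)\#G$ be the skew group algebra, that is, $S(V)\otimes kG$ with product $(r\otimes g)(s\otimes h)=r\,({}^g s)\otimes gh$, graded by $\deg v=1$, $\deg g=0$. Then $\mathcal{H}_{\lambda,\kappa}$ has the PBW property, i.e. $\mathrm{gr}\,\mathcal{H}_{\lambda,\kappa}\cong S(V)\#G$ as graded $k$-algebras, if and only if the following conditions hold for all $g,h\in G$ and $u,v,w\in V$: 1. $\lambda(gh,v)=\lambda(g,{}^h v)\,h+g\,\lambda(h,v)$ in $kG$; 2. $\kappa({}^g u,{}^g v)\,g-g\,\kappa(u,v)=\lambda(\lambda(g,v),u)-\lambda(\lambda(g,u),v)$ in $kG$; 3. $\lambda_h(g,v)\,({}^h u-{}^g u)=\lambda_h(g,u)\,({}^h v-{}^g v)$ in $V$; 4. $\kappa_g(u,v)\,({}^g w-w)+\kappa_g(v,w)\,({}^g u-u)+\kappa_g(w,u)\,({}^g v-v)=0$ in $V$; 5. $\lambda(\kappa(u,v),w)+\lambda(\kappa(v,w),u)+\lambda(\kappa(w,u),v)=0$ in $kG$. -/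

import Mathlib

/-! ### The associated graded algebra of an increasing filtration indexed by the natural numbers -/

namespace AssocGraded

open DirectSum

variable {k A : Type*} [Field k] [Ring A] [Algebra k A]

/-- The part of the filtration lying strictly below level `n`; it is `F (n - 1)` when `F` is
increasing and `0 < n`, and it is `0` for `n = 0`. -/
def below (F : ℕ → Submodule k A) (n : ℕ) : Submodule k A := ⨆ i, ⨆ (_ : i < n), F i

/-- The component `F n / F (n - 1)` of degree `n` (with `F (-1) = 0`). -/
def Piece (F : ℕ → Submodule k A) (n : ℕ) : Type _ :=
  F n ⧸ (below F n).submoduleOf (F n)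

instance (F : ℕ → Submodule k A) (n : ℕ) : AddCommGroup (Piece F n) :=
  inferInstanceAs (AddCommGroup (F n ⧸ (below F n).submoduleOf (F n)))

instance (F : ℕ → Submodule k A) (n : ℕ) : Module k (Piece F n) :=
  inferInstanceAs (Module k (F n ⧸ (below F n).submoduleOf (F n)))

/-- The quotient map `F n → F n / F (n - 1)`. -/
def proj (F : ℕ → Submodule k A) (n : ℕ) : F n →ₗ[k] Piece F n :=
  Submodule.mkQ ((below F n).submoduleOf (F n))

/-- The symbol of degree `n` of an element of `F n`. -/
def symb (F : ℕ → Submodule k A) (n : ℕ) (a : A) (ha : a ∈ F n) : Piece F n :=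
  proj F n ⟨a, ha⟩

theorem below_le_iff {F : ℕ → Submodule k A} {n : ℕ} {B : Submodule k A} :
    below F n ≤ B ↔ ∀ i < n, F i ≤ B := by
  simp [below, iSup_le_iff]

theorem le_below (F : ℕ → Submodule k A) {i n : ℕ} (h : i < n) : F i ≤ below F n :=
  le_iSup₂_of_le i h le_rfl

theorem symb_eq_zero {F : ℕ → Submodule k A} {n : ℕ} {a : A} {ha : a ∈ F n} :
    symb F n a ha = 0 ↔ a ∈ below F n :=
  Submodule.Quotient.mk_eq_zero ((below F n).submoduleOf (F n))

theorem symb_surj {F : ℕ → Submodule k A} {n : ℕ} (x : Piece F n) :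
    ∃ a ha, x = symb F n a ha := by
  obtain ⟨⟨a, ha⟩, rfl⟩ := Submodule.Quotient.mk_surjective _ x
  exact ⟨a, ha, rfl⟩

theorem mul_mem_below_right {F : ℕ → Submodule k A} [SetLike.GradedMonoid F] {i j : ℕ} {a b : A}
    (ha : a ∈ F i) (hb : b ∈ below F j) : a * b ∈ below F (i + j) := by
  have h : below F j ≤ (below F (i + j)).comap (LinearMap.mulLeft k a) :=
    below_le_iff.2 fun l hl x hx =>
      le_below F (Nat.add_lt_add_left hl i) (SetLike.GradedMul.mul_mem ha hx)
  exact h hb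

theorem mul_mem_below_left {F : ℕ → Submodule k A} [SetLike.GradedMonoid F] {i j : ℕ} {a b : A}
    (ha : a ∈ below F i) (hb : b ∈ F j) : a * b ∈ below F (i + j) := by
  have h : below F i ≤ (below F (i + j)).comap (LinearMap.mulRight k b) :=
    below_le_iff.2 fun l hl x hx =>
      le_below F (Nat.add_lt_add_right hl j) (SetLike.GradedMul.mul_mem hx hb)
  exact h ha

/-- The multiplication `F i / F (i - 1) × F j / F (j - 1) → F (i + j) / F (i + j - 1)` induced by
the multiplication of `A`. -/
def mulPiece (F : ℕ → Submodule k A) [SetLike.GradedMonoid F] (i j : ℕ) :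
    Piece F i →ₗ[k] Piece F j →ₗ[k] Piece F (i + j) :=
  Submodule.liftQ _
    (LinearMap.mk₂ k
      (fun (a : F i) (y : Piece F j) =>
        Submodule.mapQ ((below F j).submoduleOf (F j)) ((below F (i + j)).submoduleOf (F (i + j)))
          (((LinearMap.mulLeft k (a : A)).comp (F j).subtype).codRestrict (F (i + j))
            fun b => SetLike.GradedMul.mul_mem a.2 b.2)
          (fun b hb => mul_mem_below_right a.2 hb) y)
      (fun a a' y => by
        obtain ⟨b, hb, rfl⟩ := symb_surj y
        exact congrArg (proj F (i + j)) (Subtype.ext (add_mul (a : A) (a' : A) b)))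
      (fun c a y => by
        obtain ⟨b, hb, rfl⟩ := symb_surj y
        exact congrArg (proj F (i + j)) (Subtype.ext (smul_mul_assoc c (a : A) b)))
      (fun a y y' => map_add _ y y')
      (fun c a y => map_smul _ c y))
    (fun a ha => by
      refine LinearMap.mem_ker.2 (LinearMap.ext fun y => ?_)
      obtain ⟨b, hb, rfl⟩ := symb_surj y
      exact symb_eq_zero.2 (mul_mem_below_left ha hb))

theorem mulPiece_symb (F : ℕ → Submodule k A) [SetLike.GradedMonoid F] {i j : ℕ} {a b : A}
    (ha : a ∈ F i) (hb : b ∈ F j) :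
    mulPiece F i j (symb F i a ha) (symb F j b hb) =
      symb F (i + j) (a * b) (SetLike.GradedMul.mul_mem ha hb) := rfl

theorem mk_symb_congr (F : ℕ → Submodule k A) {m n : ℕ} (h : m = n) {a b : A} (hab : a = b)
    (ha : a ∈ F m) (hb : b ∈ F n) :
    GradedMonoid.mk (A := Piece F) m (symb F m a ha) = GradedMonoid.mk n (symb F n b hb) := by
  subst h; subst hab; rfl

instance gOne (F : ℕ → Submodule k A) [SetLike.GradedMonoid F] : GradedMonoid.GOne (Piece F) where
  one := symb F 0 1 SetLike.GradedOne.one_mem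

instance gMul (F : ℕ → Submodule k A) [SetLike.GradedMonoid F] : GradedMonoid.GMul (Piece F) where
  mul {i j} x y := mulPiece F i j x y

instance gRing (F : ℕ → Submodule k A) [SetLike.GradedMonoid F] : DirectSum.GRing (Piece F) where
  __ := gOne F
  __ := gMul F
  mul_zero x := map_zero (mulPiece F _ _ x)
  zero_mul y := LinearMap.map_zero₂ (mulPiece F _ _) y
  mul_add x y z := map_add (mulPiece F _ _ x) y z
  add_mul x y z := LinearMap.map_add₂ (mulPiece F _ _) x y z
  one_mul := by
    rintro ⟨i, x⟩
    obtain ⟨a, ha, rfl⟩ := symb_surj x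
    exact mk_symb_congr F (zero_add i) (one_mul a) _ _
  mul_one := by
    rintro ⟨i, x⟩
    obtain ⟨a, ha, rfl⟩ := symb_surj x
    exact mk_symb_congr F (add_zero i) (mul_one a) _ _
  mul_assoc := by
    rintro ⟨i, x⟩ ⟨j, y⟩ ⟨l, z⟩
    obtain ⟨a, ha, rfl⟩ := symb_surj x
    obtain ⟨b, hb, rfl⟩ := symb_surj y
    obtain ⟨c, hc, rfl⟩ := symb_surj z
    exact mk_symb_congr F (add_assoc i j l) (mul_assoc a b c) _ _
  natCast n := n • symb F 0 1 SetLike.GradedOne.one_mem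
  natCast_zero := zero_smul _ _
  natCast_succ n := succ_nsmul _ n
  intCast n := n • symb F 0 1 SetLike.GradedOne.one_mem
  intCast_ofNat n := natCast_zsmul _ n
  intCast_negSucc_ofNat n := negSucc_zsmul _ n

instance gAlgebra (F : ℕ → Submodule k A) [SetLike.GradedMonoid F] :
    DirectSum.GAlgebra k (Piece F) where
  toFun := (LinearMap.toSpanSingleton k (Piece F 0)
    (symb F 0 1 SetLike.GradedOne.one_mem)).toAddMonoidHom
  map_one := one_smul k (symb F 0 1 SetLike.GradedOne.one_mem)
  map_mul r s := mk_symb_congr F (zero_add 0).symm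
    (show (r * s) • (1 : A) = (r • 1) * (s • 1) by
      rw [smul_mul_smul_comm, one_mul])
    ((F 0).smul_mem _ SetLike.GradedOne.one_mem)
    (SetLike.GradedMul.mul_mem ((F 0).smul_mem _ SetLike.GradedOne.one_mem)
      ((F 0).smul_mem _ SetLike.GradedOne.one_mem))
  commutes := by
    rintro r ⟨i, x⟩
    obtain ⟨a, ha, rfl⟩ := symb_surj x
    exact mk_symb_congr F (add_comm 0 i)
      (show (r • (1 : A)) * a = a * (r • 1) by
        rw [smul_mul_assoc, one_mul, mul_smul_comm, mul_one])
      (SetLike.GradedMul.mul_mem ((F 0).smul_mem _ SetLike.GradedOne.one_mem) ha)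
      (SetLike.GradedMul.mul_mem ha ((F 0).smul_mem _ SetLike.GradedOne.one_mem))
  smul_def := by
    rintro r ⟨i, x⟩
    obtain ⟨a, ha, rfl⟩ := symb_surj x
    exact mk_symb_congr F (zero_add i).symm
      (show r • a = (r • (1 : A)) * a by rw [smul_mul_assoc, one_mul])
      ((F i).smul_mem _ ha)
      (SetLike.GradedMul.mul_mem ((F 0).smul_mem _ SetLike.GradedOne.one_mem) ha)

end AssocGraded

/-- The associated graded `k`-algebra `⨁ₙ F n / F (n - 1)`. -/
abbrev AssocGraded {k A : Type*} [Field k] [Ring A] [Algebra k A] (F : ℕ → Submodule k A)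
    [SetLike.GradedMonoid F] : Type _ :=
  DirectSum ℕ (AssocGraded.Piece F)

/-! ### The skew group algebra `S(V) # G` -/

namespace SkewSymm

variable (k G V : Type*) [Field k] [Group G] [AddCommGroup V] [Module k V]
  [DistribMulAction G V] [SMulCommClass G k V]

/-- The algebra endomorphism of `S(V)` extending the action of `g` on `V`. -/
noncomputable def act (g : G) : SymmetricAlgebra k V →ₐ[k] SymmetricAlgebra k V :=
  SymmetricAlgebra.lift (SymmetricAlgebra.ι k V ∘ₗ DistribSMul.toLinearMap k V g)

/-- `G` acts on `S(V)` by algebra automorphisms extending its action on `V`. -/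
noncomputable instance instMulSemiringAction : MulSemiringAction G (SymmetricAlgebra k V) where
  smul g x := act k G V g x
  one_smul x := by
    change act k G V 1 x = AlgHom.id k _ x
    congr 1
    ext v
    simp [act]
  mul_smul g h x := by
    change act k G V (g * h) x = ((act k G V g).comp (act k G V h)) x
    congr 1
    ext v
    simp [act, mul_smul]
  smul_zero g := map_zero (act k G V g)
  smul_add g := map_add (act k G V g)
  smul_one g := map_one (act k G V g)
  smul_mul g := map_mul (act k G V g)

instance instSMulCommClass : SMulCommClass G k (SymmetricAlgebra k V) where
  smul_comm g c x := map_smul (act k G V g) c x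

theorem smul_ι (g : G) (v : V) :
    g • SymmetricAlgebra.ι k V v = SymmetricAlgebra.ι k V (g • v) := by
  change act k G V g _ = _
  simp [act]

end SkewSymm

/-- The skew group algebra `S(V) # G`: finite sums `∑ r_g g` with `r_g ∈ S(V)`, multiplied by
`(r g) (s h) = r (ᵍs) g h`. -/
abbrev SkewSymm (k G V : Type*) [Field k] [Group G] [AddCommGroup V] [Module k V]
    [DistribMulAction G V] [SMulCommClass G k V] : Type _ :=
  SkewMonoidAlgebra (SymmetricAlgebra k V) G

/-- The homogeneous component of degree `n` of `S(V) # G`, where `V` has degree `1` and `G` has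
degree `0`: all coefficients are homogeneous of degree `n`, that is, they are linear combinations
of products of `n` vectors. -/
def SkewSymm.component (k G V : Type*) [Field k] [Group G] [AddCommGroup V] [Module k V]
    [DistribMulAction G V] [SMulCommClass G k V] (n : ℕ) : Submodule k (SkewSymm k G V) where
  carrier := {f | ∀ g : G, f.coeff g ∈ (LinearMap.range (SymmetricAlgebra.ι k V)) ^ n}
  add_mem' hf hf' g := by
    rw [SkewMonoidAlgebra.coeff_add]
    exact Submodule.add_mem _ (hf g) (hf' g)
  zero_mem' g := by
    rw [SkewMonoidAlgebra.coeff_zero]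
    exact Submodule.zero_mem _
  smul_mem' c f hf g := by
    rw [SkewMonoidAlgebra.coeff_smul]
    exact Submodule.smul_mem _ c (hf g)

/-! ### The algebra `H_{λ,κ}` -/

namespace Hecke

variable {k G V : Type*} [Field k] [Group G] [AddCommGroup V] [Module k V] [DistribMulAction G V]

/-- The free generator attached to a vector. -/
def vec (k G : Type*) {V : Type*} [Field k] (v : V) : FreeAlgebra k (V ⊕ G) :=
  FreeAlgebra.ι k (Sum.inl v)

/-- The free generator attached to a group element. -/
def grp (k : Type*) {G : Type*} (V : Type*) [Field k] (g : G) : FreeAlgebra k (V ⊕ G) :=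
  FreeAlgebra.ι k (Sum.inr g)

/-- The element `∑ x_g g` of the free algebra attached to `x = ∑ x_g g` in `kG`. -/
noncomputable def grpAlg (V : Type*) (x : MonoidAlgebra k G) : FreeAlgebra k (V ⊕ G) :=
  x.coeff.sum fun g c => c • grp k V g

/-- The defining relations of `H_{λ,κ}`: those of the vector space `V`, those of the group algebra
`kG`, and `vw - wv = κ(v,w)`, `gv - ᵍv g = λ(g,v)`. -/
inductive Rel (lam : MonoidAlgebra k G →ₗ[k] V →ₗ[k] MonoidAlgebra k G)
    (kap : V →ₗ[k] V →ₗ[k] MonoidAlgebra k G) :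
    FreeAlgebra k (V ⊕ G) → FreeAlgebra k (V ⊕ G) → Prop
  | vec_add (v w : V) : Rel lam kap (vec k G (v + w)) (vec k G v + vec k G w)
  | vec_smul (c : k) (v : V) : Rel lam kap (vec k G (c • v)) (c • vec k G v)
  | grp_one : Rel lam kap (grp k V 1) 1
  | grp_mul (g h : G) : Rel lam kap (grp k V (g * h)) (grp k V g * grp k V h)
  | comm (v w : V) :
      Rel lam kap (vec k G v * vec k G w - vec k G w * vec k G v) (grpAlg V (kap v w))
  | cross (g : G) (v : V) :
      Rel lam kap (grp k V g * vec k G v - vec k G (g • v) * grp k V g)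
        (grpAlg V (lam (MonoidAlgebra.of k G g) v))

end Hecke

/-- The `k`-algebra `H_{λ,κ}` generated by `V` and `kG` subject to `vw - wv = κ(v,w)` and
`gv - ᵍv g = λ(g,v)`. -/
abbrev Hecke {k G V : Type*} [Field k] [Group G] [AddCommGroup V] [Module k V]
    [DistribMulAction G V] (lam : MonoidAlgebra k G →ₗ[k] V →ₗ[k] MonoidAlgebra k G)
    (kap : V →ₗ[k] V →ₗ[k] MonoidAlgebra k G) : Type _ :=
  RingQuot (Hecke.Rel lam kap)

namespace Hecke

variable {k G V : Type*} [Field k] [Group G] [AddCommGroup V] [Module k V] [DistribMulAction G V]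
  (lam : MonoidAlgebra k G →ₗ[k] V →ₗ[k] MonoidAlgebra k G)
  (kap : V →ₗ[k] V →ₗ[k] MonoidAlgebra k G)

/-- The image in `H_{λ,κ}` of a generator (a vector or a group element). -/
noncomputable def gen (s : V ⊕ G) : Hecke lam kap :=
  RingQuot.mkAlgHom k (Rel lam kap) (FreeAlgebra.ι k s)

/-- The filtration by degree, with `deg v = 1` and `deg g = 0`: the `n`-th level is spanned by the
products of generators in which at most `n` factors are vectors. -/
def filt (n : ℕ) : Submodule k (Hecke lam kap) :=
  Submodule.span k
    {x | ∃ l : List (V ⊕ G), l.countP Sum.isLeft ≤ n ∧ x = (l.map (gen lam kap)).prod}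

theorem filt_mono : Monotone (filt lam kap) := fun _ _ hmn =>
  Submodule.span_mono fun _ ⟨l, hl, hx⟩ => ⟨l, hl.trans hmn, hx⟩

instance filt_gradedMonoid : SetLike.GradedMonoid (filt lam kap) where
  one_mem := Submodule.subset_span ⟨[], by simp, by simp⟩
  mul_mem i j x y hx hy := by
    have h : filt lam kap i * filt lam kap j ≤ filt lam kap (i + j) := by
      rw [filt, filt, Submodule.span_mul_span]
      refine Submodule.span_mono ?_
      rintro _ ⟨x, ⟨l, hl, rfl⟩, y, ⟨l', hl', rfl⟩, rfl⟩
      refine ⟨l ++ l', ?_, by simp⟩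
      rw [List.countP_append]
      exact Nat.add_le_add hl hl'
    exact h (Submodule.mul_mem_mul hx hy)

/-- The PBW property: `gr H_{λ,κ}` and `S(V) # G` are isomorphic as graded `k`-algebras. -/
def PBW [SMulCommClass G k V] : Prop :=
  ∃ e : AssocGraded (filt lam kap) ≃ₐ[k] SkewSymm k G V, ∀ n : ℕ,
    (LinearMap.range (DirectSum.lof k ℕ (AssocGraded.Piece (filt lam kap)) n)).map e.toLinearMap =
      SkewSymm.component k G V n

end Hecke

/-! ### Diamond lemma for rewriting systems on a free vector space -/

section NormalForm

open Finsupp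

variable {k X α : Type*} [Field k] [LinearOrder α] [WellFoundedLT α]

/-! There is a canonical surjection of graded algebras S(V) # G → gr H (`skewToGr`): commutators and
cross terms land in kG = degree 0, so their symbols vanish in degrees 2 and 1. If it is injective,
PBW holds (`pbw_of_injective`). Conversely, an abstract graded isomorphism composed with it gives
surjective endomorphisms of the finite-dimensional homogeneous components, so it is injective on
each component (`PBW.eq_zero_of_skewToGr_eq_zero`).

Both directions use two identities that hold in any algebra satisfying the cross relation. With
R(u,v) = uv - vu - κ(u,v), the element g R(u,v) - R(ᵍu,ᵍv) g has degree-one coefficients given by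
the defect of condition 3 and a kG part given by that of condition 2
(`mul_commRel_sub_commRel_mul`); the cyclic sum of [w, R(u,v)] encodes conditions 4 and 5 in the
same way (`commRel_jacobi`).

Necessity: in H every R(u,v) is zero, and PBW makes the elements vg and g independent, so all these
coefficients vanish. Condition 1 comes from moving gh past v in one step or in two.

Sufficiency: kG acts on T(V) ⊗ kG by pushing group elements to the right; condition 1 makes this
action multiplicative, and conditions 1-3 make the span of the elements a R(u,v) m stable under it.
The quotient by that span is therefore an H-module. Rewriting descents ji (i < j) to ij + κ(j,i)
terminates, and it is confluent (`rewriteRel_sub_mem`): overlaps lji are resolved by conditions 4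
and 5, disjoint descents by conditions 1-3. The resulting normal form N kills the relations and
fixes sorted words. Hence a ↦ N(a · 1) is a filtered map from H to T(V) ⊗ kG sending sorted
monomials to distinct basis words, which forces injectivity of `skewToGr` (`skewToGr_injective`). -/

open Classical in
/-- The normal form of the basis vector `x`, where each `d ∈ S x` is a relation rewriting `x` to
`x - d`; normal forms are computed by recursion along `μ`. -/
noncomputable def normalForm (μ : X → α) (S : X → Set (X →₀ k)) : X → X →₀ k :=
  (InvImage.wf μ (wellFounded_lt (α := α))).fix fun x rec =>
    if h : (S x).Nonempty then
      linearCombination k (fun y => if hy : μ y < μ x then rec y hy else 0) (single x 1 - h.some)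
    else single x 1

theorem normalForm_of_nonempty {μ : X → α} {S : X → Set (X →₀ k)} {x : X} (h : (S x).Nonempty)
    (hS : single x 1 - h.some ∈ supported k k {y | μ y < μ x}) :
    normalForm μ S x = linearCombination k (normalForm μ S) (single x 1 - h.some) := by
  rw [normalForm, WellFounded.fix_eq, dif_pos h]
  rw [linearCombination_apply, linearCombination_apply]
  refine Finsupp.sum_congr fun y hy => ?_
  have hy' : μ y < μ x := (mem_supported _ _).1 hS hy
  rw [dif_pos hy']

theorem normalForm_of_eq_empty {μ : X → α} {S : X → Set (X →₀ k)} {x : X} (h : S x = ∅) :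
    normalForm μ S x = single x 1 := by
  rw [normalForm, WellFounded.fix_eq, dif_neg (by simp [h])]

/-- The diamond lemma: if the relations with the same leading basis vector agree modulo relations
with smaller leading basis vectors, then the normal form kills all relations. -/
theorem linearCombination_normalForm_eq_zero (μ : X → α) (S : X → Set (X →₀ k))
    (hS : ∀ x, ∀ d ∈ S x, single x 1 - d ∈ supported k k {y | μ y < μ x})
    (hconf : ∀ x, ∀ d ∈ S x, ∀ d' ∈ S x, d - d' ∈ Submodule.span k {e | ∃ y, μ y < μ x ∧ e ∈ S y})
    (x : X) (d : X →₀ k) (hd : d ∈ S x) :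
    linearCombination k (normalForm μ S) d = 0 := by
  induction x using (InvImage.wf μ (wellFounded_lt (α := α))).induction generalizing d with
  | _ x ih =>
    have hne : (S x).Nonempty := ⟨d, hd⟩
    -- The relation chosen in the definition of the normal form is killed by construction; any other
    -- relation at `x` differs from it by lower ones, which the induction handles.
    have h1 : linearCombination k (normalForm μ S) hne.some = 0 := by
      have := normalForm_of_nonempty hne (hS x _ hne.some_mem)
      rw [map_sub, linearCombination_single, one_smul] at this
      exact sub_eq_self.1 this.symm
    have h2 : Submodule.span k {e | ∃ y, μ y < μ x ∧ e ∈ S y} ≤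
        LinearMap.ker (linearCombination k (normalForm μ S)) :=
      Submodule.span_le.2 fun e ⟨y, hy, he⟩ => ih y hy e he
    have h3 := LinearMap.mem_ker.1 (h2 (hconf x d hd _ hne.some_mem))
    rwa [map_sub, h1, sub_zero] at h3

theorem normalForm_mem_supported (μ : X → α) (S : X → Set (X →₀ k))
    (hS : ∀ x, ∀ d ∈ S x, single x 1 - d ∈ supported k k {y | μ y < μ x}) (x : X) :
    normalForm μ S x ∈ supported k k {y | μ y ≤ μ x} := by
  induction x using (InvImage.wf μ (wellFounded_lt (α := α))).induction with
  | _ x ih =>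
    rcases (S x).eq_empty_or_nonempty with h | h
    · rw [normalForm_of_eq_empty h]
      exact single_mem_supported k 1 le_rfl
    · have hx := hS x _ h.some_mem
      rw [normalForm_of_nonempty h hx, linearCombination_apply]
      refine Submodule.sum_mem _ fun y hy => Submodule.smul_mem _ _ ?_
      have hy' : μ y < μ x := (mem_supported _ _).1 hx hy
      exact supported_mono (fun z hz => le_trans hz hy'.le) (ih y hy')

end NormalForm

/-! ### Identities in an arbitrary algebra satisfying the cross relation -/

section CrossRelation

open MonoidAlgebra

variable {k G V E : Type*} [Field k] [Group G] [Fintype G] [AddCommGroup V] [Module k V]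
  [DistribMulAction G V] [Ring E] [Algebra k E]
  {lam : MonoidAlgebra k G →ₗ[k] V →ₗ[k] MonoidAlgebra k G}
  {kap : V →ₗ[k] V →ₗ[k] MonoidAlgebra k G}
  {X : V →ₗ[k] E} {L : MonoidAlgebra k G →ₗ[k] E}

theorem MonoidAlgebra.eq_sum_smul_of (x : MonoidAlgebra k G) :
    x = ∑ g, x.coeff g • of k G g := by
  ext h
  simp

theorem MonoidAlgebra.map_eq_sum_coeff_smul (f : MonoidAlgebra k G →ₗ[k] E)
    (x : MonoidAlgebra k G) : f x = ∑ g, x.coeff g • f (of k G g) := by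
  conv_lhs => rw [eq_sum_smul_of x]
  simp only [map_sum, map_smul]

/-- The cross relation `g v = ᵍv g + λ(g,v)` extends to `x v = ∑ x_g ᵍv g + λ(x,v)`. -/
theorem mul_eq_sum_of_cross
    (hX : ∀ g v, L (of k G g) * X v = X (g • v) * L (of k G g) + L (lam (of k G g) v))
    (x : MonoidAlgebra k G) (v : V) :
    L x * X v = ∑ g, x.coeff g • (X (g • v) * L (of k G g)) + L (lam x v) := by
  rw [map_eq_sum_coeff_smul L x, Finset.sum_mul]
  conv_rhs => rw [eq_sum_smul_of x]
  simp only [map_sum, map_smul, LinearMap.sum_apply, LinearMap.smul_apply, smul_mul_assoc, hX,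
    smul_add, Finset.sum_add_distrib]
  congr 1
  refine Finset.sum_congr rfl fun g _ => ?_
  conv_lhs => rw [eq_sum_smul_of x]

variable (X L kap) in
/-- The commutator relation `uv - vu - κ(u,v)`. -/
noncomputable def commRel : V →ₗ[k] V →ₗ[k] E :=
  (LinearMap.mul k E).compl₁₂ X X - ((LinearMap.mul k E).compl₁₂ X X).flip - kap.compr₂ L

omit [Group G] [Fintype G] [DistribMulAction G V] in
theorem commRel_apply (u v : V) :
    commRel kap X L u v = X u * X v - X v * X u - L (kap u v) := rfl

/-- The failure of the commutator relations to be permuted by G: its terms in V·kG measure condition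
3, its term in kG condition 2. Here `L` must be multiplicative, because g κ(u,v) and κ(ᵍu,ᵍv) g are
formed inside kG. -/
theorem mul_commRel_sub_commRel_mul {L : MonoidAlgebra k G →ₐ[k] E}
    (hX : ∀ g v, L (of k G g) * X v = X (g • v) * L (of k G g) + L (lam (of k G g) v))
    (g : G) (u v : V) :
    L (of k G g) * commRel kap X L.toLinearMap u v -
        commRel kap X L.toLinearMap (g • u) (g • v) * L (of k G g) =
      ∑ h, X ((lam (of k G g) v).coeff h • (g • u - h • u) -
        (lam (of k G g) u).coeff h • (g • v - h • v)) * L (of k G h) +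
      L (kap (g • u) (g • v) * of k G g - of k G g * kap u v -
        (lam (lam (of k G g) v) u - lam (lam (of k G g) u) v)) := by
  -- Push g past u and then past v; antisymmetrizing in u and v gives the claim.
  have key : ∀ u v : V, L (of k G g) * (X u * X v) = X (g • u) * X (g • v) * L (of k G g) +
      ∑ h, (lam (of k G g) v).coeff h • (X (g • u) * L (of k G h)) +
      ∑ h, (lam (of k G g) u).coeff h • (X (h • v) * L (of k G h)) +
      L (lam (lam (of k G g) u) v) := by
    intro u v
    have h1 := mul_eq_sum_of_cross (L := L.toLinearMap) hX (lam (of k G g) u) v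
    have h2 : L (lam (of k G g) v) = _ :=
      map_eq_sum_coeff_smul L.toLinearMap (lam (of k G g) v)
    simp only [AlgHom.toLinearMap_apply] at h1 h2
    rw [← mul_assoc, hX, add_mul, h1, mul_assoc, hX, mul_add, h2, Finset.mul_sum]
    simp only [mul_smul_comm, mul_assoc, add_assoc]
  simp only [commRel_apply, mul_sub, sub_mul, key, AlgHom.toLinearMap_apply, map_sub, map_mul, map_smul,
    smul_mul_assoc, smul_sub, Finset.sum_sub_distrib]
  abel

/-- The cubic terms cancel by the Jacobi identity for commutators. What survives is the cyclic sum
of [κ(u,v), w], expanded by the cross relation. -/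
theorem commRel_jacobi {L : MonoidAlgebra k G →ₗ[k] E}
    (hX : ∀ g v, L (of k G g) * X v = X (g • v) * L (of k G g) + L (lam (of k G g) v))
    (u v w : V) :
    (X w * commRel kap X L u v - commRel kap X L u v * X w) +
    (X u * commRel kap X L v w - commRel kap X L v w * X u) +
    (X v * commRel kap X L w u - commRel kap X L w u * X v) =
      ∑ g, X ((kap u v).coeff g • (g • w - w) + (kap v w).coeff g • (g • u - u) +
          (kap w u).coeff g • (g • v - v)) * L (of k G g) +
      L (lam (kap u v) w + lam (kap v w) u + lam (kap w u) v) := by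
  have key : ∀ u v w : V, X w * commRel kap X L u v - commRel kap X L u v * X w =
      X w * (X u * X v) - X w * (X v * X u) - X u * (X v * X w) + X v * (X u * X w) +
      (∑ g, (kap u v).coeff g • (X (g • w) * L (of k G g)) -
        ∑ g, (kap u v).coeff g • (X w * L (of k G g))) + L (lam (kap u v) w) := by
    intro u v w
    have h1 := mul_eq_sum_of_cross hX (kap u v) w
    have h2 : X w * L (kap u v) = ∑ g, (kap u v).coeff g • (X w * L (of k G g)) := by
      rw [map_eq_sum_coeff_smul L (kap u v), Finset.mul_sum]
      simp only [mul_smul_comm]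
    simp only [commRel_apply, mul_sub, sub_mul, h1, h2, mul_assoc]
    abel
  simp only [key, map_add, map_sub, map_smul, add_mul, sub_mul, smul_mul_assoc, smul_sub,
    Finset.sum_sub_distrib, Finset.sum_add_distrib]
  abel

omit [Fintype G] [DistribMulAction G V] in
theorem commRel_self {L : MonoidAlgebra k G →ₗ[k] E} (hkap : ∀ v, kap v v = 0) (v : V) :
    commRel kap X L v v = 0 := by
  rw [commRel_apply, hkap, map_zero, sub_self, sub_zero]

omit [Fintype G] [DistribMulAction G V] in
theorem commRel_neg {L : MonoidAlgebra k G →ₗ[k] E} (hkap : ∀ v, kap v v = 0) (u v : V) :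
    commRel kap X L u v = - commRel kap X L v u := by
  have := commRel_self (X := X) (L := L) hkap (u + v)
  simp only [map_add, LinearMap.add_apply, commRel_self hkap, zero_add, add_zero] at this
  rw [eq_neg_iff_add_eq_zero, add_comm]
  exact this

/-- The left side is the difference of the two ways to start rewriting uvw when u > v > w. Under
conditions 4 and 5 the Jacobi identity turns it into relations whose leading words wuv, vwu, vuw,
uwv are all smaller than uvw. -/
theorem commRel_mul_sub_mul_commRel {L : MonoidAlgebra k G →ₗ[k] E}
    (hX : ∀ g v, L (of k G g) * X v = X (g • v) * L (of k G g) + L (lam (of k G g) v))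
    (hkap : ∀ v, kap v v = 0)
    (h4 : ∀ (g : G) (u v w : V), (kap u v).coeff g • (g • w - w) +
      (kap v w).coeff g • (g • u - u) + (kap w u).coeff g • (g • v - v) = 0)
    (h5 : ∀ u v w : V, lam (kap u v) w + lam (kap v w) u + lam (kap w u) v = 0) (u v w : V) :
    commRel kap X L u v * X w - X u * commRel kap X L v w =
      X w * commRel kap X L u v - commRel kap X L v w * X u -
        X v * commRel kap X L u w + commRel kap X L u w * X v := by
  have hJ := commRel_jacobi (kap := kap) hX u v w
  simp only [h4, h5, map_zero, zero_mul, Finset.sum_const_zero, add_zero] at hJ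
  rw [commRel_neg hkap w u] at hJ
  rw [← sub_eq_zero, ← neg_eq_zero, ← hJ]
  noncomm_ring

end CrossRelation

/-! ### Operators of V and kG on T(V) ⊗ kG -/

section WordModule

open MonoidAlgebra Finsupp

variable {k G V ι : Type*} [Field k] [AddCommGroup V] [Module k V]

/-- The free module `T(V) ⊗ kG`, with basis the pairs of a word in the basis vectors of `V` and a
group element. -/
abbrev WordModule (k G ι : Type*) [Field k] : Type _ := (List ι × G) →₀ k

/-- The basis vector of `T(V) ⊗ kG` attached to a word and a group element. -/
noncomputable def word (k : Type*) {G ι : Type*} [Field k] (l : List ι) (g : G) :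
    WordModule k G ι := single (l, g) 1

/-- The span of the words of length at most `n`. -/
def wordLE (k G ι : Type*) [Field k] (n : ℕ) : Submodule k (WordModule k G ι) :=
  supported k k {p | p.1.length ≤ n}

theorem wordLE_mono : Monotone (wordLE k G ι) := fun _ _ h =>
  supported_mono fun _ hp => le_trans hp h

theorem word_mem_wordLE {l : List ι} {g : G} {n : ℕ} (h : l.length ≤ n) :
    word k l g ∈ wordLE k G ι n := single_mem_supported k 1 h

theorem map_wordLE_le {M : Type*} [AddCommGroup M] [Module k M] (f : WordModule k G ι →ₗ[k] M)
    {B : Submodule k M} {n : ℕ} (h : ∀ l g, l.length ≤ n → f (word k l g) ∈ B)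
    {m : WordModule k G ι} (hm : m ∈ wordLE k G ι n) : f m ∈ B := by
  rw [← sum_single m, Finsupp.sum, map_sum]
  refine Submodule.sum_mem _ fun p hp => ?_
  rw [← mul_one (m p), ← smul_eq_mul, ← Finsupp.smul_single, map_smul]
  exact B.smul_mem _ (h p.1 p.2 ((mem_supported _ _).1 hm hp))

variable (b : Module.Basis ι k V)

/-- Left multiplication by a vector on `T(V) ⊗ kG`. -/
noncomputable def vecOp (G : Type*) : V →ₗ[k] Module.End k (WordModule k G ι) :=
  b.constr k fun i => lmapDomain k k fun p => (i :: p.1, p.2)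

theorem vecOp_basis_word (i : ι) (l : List ι) (g : G) :
    vecOp b G (b i) (word k l g) = word k (i :: l) g := by
  rw [vecOp, Module.Basis.constr_basis, word, lmapDomain_apply, Finsupp.mapDomain_single]
  rfl

theorem vecOp_mem_of_basis {B C : Submodule k (WordModule k G ι)}
    (h : ∀ i, ∀ m ∈ B, vecOp b G (b i) m ∈ C) (v : V) {m : WordModule k G ι} (hm : m ∈ B) :
    vecOp b G v m ∈ C := by
  rw [← b.linearCombination_repr v, linearCombination_apply, Finsupp.sum, map_sum,
    LinearMap.sum_apply]
  refine Submodule.sum_mem _ fun i _ => ?_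
  rw [map_smul, LinearMap.smul_apply]
  exact C.smul_mem _ (h i m hm)

theorem vecOp_mem_wordLE (v : V) {n : ℕ} {m : WordModule k G ι} (hm : m ∈ wordLE k G ι n) :
    vecOp b G v m ∈ wordLE k G ι (n + 1) :=
  vecOp_mem_of_basis b (fun i _ hm => map_wordLE_le _ (fun l g hl => by
    rw [vecOp_basis_word]
    exact word_mem_wordLE (by simpa using hl)) hm) v hm

variable [Group G] [DistribMulAction G V]
  (lam : MonoidAlgebra k G →ₗ[k] V →ₗ[k] MonoidAlgebra k G)
  (kap : V →ₗ[k] V →ₗ[k] MonoidAlgebra k G)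

/-- The product of a group element with a word, computed by moving the group element to the right
using `g v = ᵍv g + λ(g,v)`. -/
noncomputable def grpWord : List ι → G → G → WordModule k G ι
  | [], g, h => word k [] (g * h)
  | i :: l, g, h => vecOp b G (g • b i) (grpWord l g h) +
      (lam (of k G g) (b i)).coeff.sum fun g' c => c • grpWord l g' h

/-- Left multiplication by a group element on `T(V) ⊗ kG`. -/
noncomputable def grpOp (g : G) : Module.End k (WordModule k G ι) :=
  linearCombination k fun p => grpWord b lam p.1 g p.2

/-- Left multiplication by an element of `kG` on `T(V) ⊗ kG`. -/
noncomputable def algOp : MonoidAlgebra k G →ₗ[k] Module.End k (WordModule k G ι) :=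
  linearCombination k (grpOp b lam) ∘ₗ (coeffLinearEquiv k).toLinearMap

theorem algOp_apply (x : MonoidAlgebra k G) :
    algOp b lam x = x.coeff.sum fun g c => c • grpOp b lam g := rfl

theorem algOp_of (g : G) : algOp b lam (of k G g) = grpOp b lam g := by
  simp [algOp_apply]

theorem grpOp_word (g : G) (l : List ι) (h : G) :
    grpOp b lam g (word k l h) = grpWord b lam l g h := by
  simp [grpOp, word]

/-- Built into the recursion defining `grpWord`; none of the five conditions is needed. -/
theorem algOp_mul_vecOp [SMulCommClass G k V] (g : G) (v : V) :
    algOp b lam (of k G g) * vecOp b G v =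
      vecOp b G (g • v) * algOp b lam (of k G g) + algOp b lam (lam (of k G g) v) := by
  have h : LinearMap.mulLeft k (algOp b lam (of k G g)) ∘ₗ vecOp b G =
      LinearMap.mulRight k (algOp b lam (of k G g)) ∘ₗ vecOp b G ∘ₗ
        DistribSMul.toLinearMap k V g + algOp b lam ∘ₗ lam (of k G g) := by
    refine b.ext fun i => lhom_ext' fun ⟨l, h⟩ => LinearMap.ext_ring ?_
    change algOp b lam (of k G g) (vecOp b G (b i) (word k l h)) =
      vecOp b G (g • b i) (algOp b lam (of k G g) (word k l h)) +
        algOp b lam (lam (of k G g) (b i)) (word k l h)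
    rw [vecOp_basis_word, algOp_of, grpOp_word, grpOp_word, grpWord, algOp_apply, Finsupp.sum,
      Finsupp.sum, LinearMap.sum_apply]
    simp only [LinearMap.smul_apply, grpOp_word]
  exact LinearMap.congr_fun h v

/-- Since λ takes values in kG, pushing a group element to the right replaces or deletes letters but
never adds any. -/
theorem algOp_mem_wordLE (x : MonoidAlgebra k G) {n : ℕ} {m : WordModule k G ι}
    (hm : m ∈ wordLE k G ι n) : algOp b lam x m ∈ wordLE k G ι n := by
  have key : ∀ (l : List ι) (g h : G), grpWord b lam l g h ∈ wordLE k G ι l.length := by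
    intro l
    induction l with
    | nil => exact fun g h => word_mem_wordLE le_rfl
    | cons i l ih =>
      intro g h
      refine Submodule.add_mem _ (vecOp_mem_wordLE b _ (ih g h)) ?_
      exact Submodule.sum_mem _ fun g' _ => Submodule.smul_mem _ _
        (wordLE_mono (Nat.le_succ _) (ih g' h))
  rw [algOp_apply, Finsupp.sum, LinearMap.sum_apply]
  refine Submodule.sum_mem _ fun g _ => Submodule.smul_mem _ _ ?_
  refine map_wordLE_le _ (fun l h hl => ?_) hm
  rw [grpOp_word]
  exact wordLE_mono hl (key l g h)

section Mul

variable {lam} [SMulCommClass G k V]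
  (h1 : ∀ (g h : G) (v : V), lam (of k G (g * h)) v =
    lam (of k G g) (h • v) * of k G h + of k G g * lam (of k G h) v)

include h1

/-- Condition 1 says that moving gh past a letter at once, or h and then g, leaves the same
correction term. The rest is induction on the word. -/
theorem grpOp_mul_grpOp (g h : G) : grpOp b lam g * grpOp b lam h = grpOp b lam (g * h) := by
  refine lhom_ext' fun ⟨l, r⟩ => LinearMap.ext_ring ?_
  change grpOp b lam g (grpOp b lam h (word k l r)) = grpOp b lam (g * h) (word k l r)
  induction l generalizing g h with
  | nil => rw [grpOp_word, grpWord, grpOp_word, grpOp_word, grpWord, grpWord, mul_assoc]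
  | cons i l ih =>
    -- The correction terms lie in kG, so the induction hypothesis is needed with one factor
    -- replaced by an arbitrary element of kG, on either side.
    have hA : ∀ (x : MonoidAlgebra k G) (s : G),
        algOp b lam x (grpOp b lam s (word k l r)) = algOp b lam (x * of k G s) (word k l r) := by
      intro x s
      induction x using MonoidAlgebra.induction_linear with
      | zero => simp
      | add x y hx hy => simp only [map_add, add_mul, LinearMap.add_apply, hx, hy]
      | single t c =>
        have : (single t c : MonoidAlgebra k G) = c • of k G t := by simp
        rw [this, smul_mul_assoc, map_smul, map_smul, ← map_mul, algOp_of, algOp_of,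
          LinearMap.smul_apply, LinearMap.smul_apply, ih]
    have hB : ∀ (x : MonoidAlgebra k G) (s : G),
        grpOp b lam s (algOp b lam x (word k l r)) = algOp b lam (of k G s * x) (word k l r) := by
      intro x s
      induction x using MonoidAlgebra.induction_linear with
      | zero => simp
      | add x y hx hy => simp only [map_add, mul_add, LinearMap.add_apply, hx, hy]
      | single t c =>
        have : (single t c : MonoidAlgebra k G) = c • of k G t := by simp
        rw [this, mul_smul_comm, map_smul, map_smul, ← map_mul, algOp_of, algOp_of,
          LinearMap.smul_apply, LinearMap.smul_apply, map_smul, ih]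
    have hX : ∀ (s : G) (v : V) (m : WordModule k G ι), grpOp b lam s (vecOp b G v m) =
        vecOp b G (s • v) (grpOp b lam s m) + algOp b lam (lam (of k G s) v) m := by
      intro s v m
      have := LinearMap.congr_fun (algOp_mul_vecOp b lam s v) m
      rwa [algOp_of] at this
    rw [← vecOp_basis_word b, hX, hX, map_add, hX, ih, hA, hB, mul_smul, h1, map_add,
      LinearMap.add_apply, add_assoc]

-- At g = h = 1, condition 1 reads λ(1,v) = λ(1,v) + λ(1,v).
omit [SMulCommClass G k V] in
theorem lam_of_one (v : V) : lam (of k G 1) v = 0 := by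
  have := h1 1 1 v
  rw [mul_one, one_smul, map_one, mul_one, one_mul] at this
  rw [map_one]
  exact left_eq_add.1 this

omit [SMulCommClass G k V] in
theorem grpOp_one : grpOp b lam (1 : G) = 1 := by
  refine lhom_ext' fun ⟨l, r⟩ => LinearMap.ext_ring ?_
  change grpOp b lam 1 (word k l r) = word k l r
  induction l with
  | nil => rw [grpOp_word, grpWord, one_mul]
  | cons i l ih =>
    rw [grpOp_word, grpWord, lam_of_one h1, ← grpOp_word, ih, one_smul, vecOp_basis_word]
    simp

/-- The left action of the group algebra on `T(V) ⊗ kG`. -/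
noncomputable def algOpHom : MonoidAlgebra k G →ₐ[k] Module.End k (WordModule k G ι) :=
  MonoidAlgebra.lift k (Module.End k (WordModule k G ι)) G
    { toFun := grpOp b lam
      map_one' := grpOp_one b h1
      map_mul' := fun g h => (grpOp_mul_grpOp b h1 g h).symm }

theorem algOpHom_toLinearMap : (algOpHom b h1).toLinearMap = algOp b lam := by
  refine LinearMap.ext fun x => ?_
  rw [AlgHom.toLinearMap_apply, algOpHom, MonoidAlgebra.lift_apply, algOp_apply]
  rfl

end Mul

end WordModule

/-! ### The span of the commutator relations and its stability -/

section Relations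

open Finsupp

open MonoidAlgebra (of)

variable {k G V ι : Type*} [Field k] [AddCommGroup V] [Module k V] (b : Module.Basis ι k V)

/-- Left multiplication by a word on `T(V) ⊗ kG`. -/
noncomputable def prefixOp (G : Type*) (a : List ι) : Module.End k (WordModule k G ι) :=
  (a.map fun i => vecOp b G (b i)).prod

theorem prefixOp_cons (i : ι) (a : List ι) :
    prefixOp b G (i :: a) = vecOp b G (b i) * prefixOp b G a := by
  simp [prefixOp]

theorem prefixOp_append (a c : List ι) :
    prefixOp b G (a ++ c) = prefixOp b G a * prefixOp b G c := by
  simp [prefixOp]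

theorem prefixOp_word (a l : List ι) (g : G) :
    prefixOp b G a (word k l g) = word k (a ++ l) g := by
  induction a with
  | nil => simp [prefixOp]
  | cons i a ih => rw [prefixOp_cons, Module.End.mul_apply, ih, vecOp_basis_word, List.cons_append]

theorem prefixOp_mem_wordLE (a : List ι) {n : ℕ} {m : WordModule k G ι}
    (hm : m ∈ wordLE k G ι n) : prefixOp b G a m ∈ wordLE k G ι (a.length + n) :=
  map_wordLE_le _ (fun l g hl => by
    rw [prefixOp_word]
    exact word_mem_wordLE (by simpa using hl)) hm

variable [Group G] [DistribMulAction G V]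
  (lam : MonoidAlgebra k G →ₗ[k] V →ₗ[k] MonoidAlgebra k G)
  (kap : V →ₗ[k] V →ₗ[k] MonoidAlgebra k G)

/-- Left multiplication by `uv - vu - κ(u,v)` on `T(V) ⊗ kG`. -/
noncomputable def wordRel : V →ₗ[k] V →ₗ[k] Module.End k (WordModule k G ι) :=
  commRel (E := Module.End k (WordModule k G ι)) kap (vecOp b G) (algOp b lam)

theorem wordRel_apply (u v : V) : wordRel b lam kap u v =
    vecOp b G u * vecOp b G v - vecOp b G v * vecOp b G u - algOp b lam (kap u v) := rfl

/-- The span of the elements `a (uv - vu - κ(u,v)) m` of degree at most `n`. -/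
noncomputable def relLE (n : ℕ) : Submodule k (WordModule k G ι) :=
  Submodule.span k {d | ∃ (a : List ι) (u v : V) (c : ℕ), a.length + 2 + c ≤ n ∧
    ∃ m ∈ wordLE k G ι c, d = prefixOp b G a (wordRel b lam kap u v m)}

theorem relLE_mono : Monotone (relLE b lam kap) := fun _ _ h =>
  Submodule.span_mono fun _ ⟨a, u, v, c, hc, hm⟩ => ⟨a, u, v, c, hc.trans h, hm⟩

theorem prefixOp_commRel_mem_relLE {a : List ι} {u v : V} {c n : ℕ} {m : WordModule k G ι}
    (hm : m ∈ wordLE k G ι c) (h : a.length + 2 + c ≤ n) :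
    prefixOp b G a (wordRel b lam kap u v m) ∈ relLE b lam kap n :=
  Submodule.subset_span ⟨a, u, v, c, h, m, hm, rfl⟩

theorem vecOp_mem_relLE {n : ℕ} (v : V) {m : WordModule k G ι} (hm : m ∈ relLE b lam kap n) :
    vecOp b G v m ∈ relLE b lam kap (n + 1) := by
  refine vecOp_mem_of_basis b (B := relLE b lam kap n) (fun i m hm => ?_) v hm
  suffices h : relLE b lam kap n ≤ (relLE b lam kap (n + 1)).comap (vecOp b G (b i)) from h hm
  refine Submodule.span_le.2 ?_
  rintro _ ⟨a, u, v, c, hc, m, hm, rfl⟩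
  change vecOp b G (b i) _ ∈ relLE b lam kap (n + 1)
  rw [← Module.End.mul_apply, ← prefixOp_cons]
  exact prefixOp_commRel_mem_relLE b lam kap hm (by simp only [List.length_cons]; omega)

theorem prefixOp_mem_relLE {n : ℕ} (a : List ι) {m : WordModule k G ι}
    (hm : m ∈ relLE b lam kap n) : prefixOp b G a m ∈ relLE b lam kap (a.length + n) := by
  induction a with
  | nil => simpa [prefixOp] using hm
  | cons i a ih =>
    rw [prefixOp_cons, Module.End.mul_apply, List.length_cons, Nat.add_right_comm]
    exact vecOp_mem_relLE b lam kap _ ih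

theorem algOp_mem_of_grpOp {B C : Submodule k (WordModule k G ι)}
    (h : ∀ g, ∀ m ∈ B, algOp b lam (of k G g) m ∈ C) (x : MonoidAlgebra k G)
    {m : WordModule k G ι} (hm : m ∈ B) : algOp b lam x m ∈ C := by
  rw [algOp_apply, Finsupp.sum, LinearMap.sum_apply]
  refine Submodule.sum_mem _ fun g _ => Submodule.smul_mem _ _ ?_
  rw [← algOp_of]
  exact h g m hm

/-- The leading word rewriting relations `a (uv - vu - κ(u,v)) c g` for basis vectors `v < u`. -/
def rewriteRel [LT ι] (x : List ι × G) : Set (WordModule k G ι) :=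
  {d | ∃ (a : List ι) (j i : ι) (c : List ι) (g : G), i < j ∧ x = (a ++ j :: i :: c, g) ∧
    d = prefixOp b G a (wordRel b lam kap (b j) (b i) (word k c g))}

section Hypotheses

variable {lam kap} [Fintype G] [SMulCommClass G k V]
  (h1 : ∀ (g h : G) (v : V), lam (of k G (g * h)) v =
    lam (of k G g) (h • v) * of k G h + of k G g * lam (of k G h) v)
  (h2 : ∀ (g : G) (u v : V), kap (g • u) (g • v) * of k G g - of k G g * kap u v =
    lam (lam (of k G g) v) u - lam (lam (of k G g) u) v)
  (h3 : ∀ (g h : G) (u v : V), (lam (of k G g) v).coeff h • (h • u - g • u) =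
    (lam (of k G g) u).coeff h • (h • v - g • v))

include h1 h2 h3

/-- Condition 1 upgrades `algOp` to an algebra map, so that `mul_commRel_sub_commRel_mul` applies;
conditions 2 and 3 then kill its right side. -/
theorem algOp_mul_commRel (g : G) (u v : V) :
    algOp b lam (of k G g) * wordRel b lam kap u v =
      wordRel b lam kap (g • u) (g • v) * algOp b lam (of k G g) := by
  have h := mul_commRel_sub_commRel_mul (E := Module.End k (WordModule k G ι))
    (X := vecOp b G) (L := algOpHom b h1) (lam := lam) (kap := kap) (fun g v => by
      have := algOp_mul_vecOp b lam g v
      rwa [← algOpHom_toLinearMap b h1] at this) g u v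
  have e : ∀ x, algOpHom b h1 x = algOp b lam x := fun x => by
    rw [← algOpHom_toLinearMap b h1]; rfl
  rw [h2, sub_self, map_zero, add_zero, algOpHom_toLinearMap, e] at h
  rw [← sub_eq_zero]
  refine h.trans ?_
  refine Finset.sum_eq_zero fun s _ => ?_
  have : (lam (of k G g) v).coeff s • (g • u - s • u) -
      (lam (of k G g) u).coeff s • (g • v - s • v) = 0 := by
    rw [← neg_sub (s • u), ← neg_sub (s • v), smul_neg, smul_neg, h3, sub_self]
  rw [this, map_zero, zero_mul]

/-- Move the group element through the prefix letter by letter until it meets the commutator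
relation, where `algOp_mul_commRel` takes it across. This makes the quotient by the relations a
kG-module and also settles disjoint descents. -/
theorem algOp_mem_relLE (x : MonoidAlgebra k G) {n : ℕ} {m : WordModule k G ι}
    (hm : m ∈ relLE b lam kap n) : algOp b lam x m ∈ relLE b lam kap n := by
  refine algOp_mem_of_grpOp b lam (B := relLE b lam kap n) (fun g m hm => ?_) x hm
  suffices h : relLE b lam kap n ≤ (relLE b lam kap n).comap (algOp b lam (of k G g)) from h hm
  refine Submodule.span_le.2 ?_
  rintro _ ⟨a, u, v, c, hc, m, hm, rfl⟩
  change algOp b lam (of k G g) _ ∈ relLE b lam kap n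
  refine relLE_mono b lam kap hc ?_
  clear hc
  induction a generalizing g with
  | nil =>
    have := LinearMap.congr_fun (algOp_mul_commRel b h1 h2 h3 g u v) m
    simp only [Module.End.mul_apply] at this
    simp only [prefixOp, List.map_nil, List.prod_nil, Module.End.one_apply, this]
    exact prefixOp_commRel_mem_relLE b lam kap (a := []) (algOp_mem_wordLE b lam _ hm) le_rfl
  | cons i a ih =>
    have := LinearMap.congr_fun (algOp_mul_vecOp b lam g (b i))
      (prefixOp b G a (wordRel b lam kap u v m))
    simp only [Module.End.mul_apply, LinearMap.add_apply] at this
    rw [prefixOp_cons, Module.End.mul_apply, this]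
    have e : (i :: a).length + 2 + c = a.length + 2 + c + 1 := by
      simp only [List.length_cons]; omega
    rw [e]
    refine Submodule.add_mem _ (vecOp_mem_relLE b lam kap _ (ih g)) ?_
    rw [algOp_apply, Finsupp.sum, LinearMap.sum_apply]
    refine Submodule.sum_mem _ fun s _ => Submodule.smul_mem _ _ ?_
    rw [← algOp_of]
    -- The λ-terms have lost the letter `i`, so they lie one degree lower.
    exact relLE_mono b lam kap (Nat.le_succ _) (ih s)

end Hypotheses

end Relations

/-! ### Termination and confluence of the rewriting system -/

section Confluence

open Finsupp

open MonoidAlgebra (of)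

/-- A weight on words which drops when an adjacent inversion is resolved. -/
def wordWeight {n : ℕ} : List (Fin n) → ℕ
  | [] => 0
  | i :: l => i * (l.length + 1) + wordWeight l

theorem wordWeight_append_lt {n : ℕ} (a : List (Fin n)) {l l' : List (Fin n)}
    (hl : l.length = l'.length) (h : wordWeight l < wordWeight l') :
    wordWeight (a ++ l) < wordWeight (a ++ l') := by
  induction a with
  | nil => exact h
  | cons i a ih =>
    simp only [List.cons_append, wordWeight, List.length_append, hl]
    omega

/-- With m the length of `c`, the weight drops by (j(m+2) + i(m+1)) - (i(m+2) + j(m+1)) = j - i. -/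
theorem wordWeight_swap {n : ℕ} {i j : Fin n} (h : i < j) (c : List (Fin n)) :
    wordWeight (i :: j :: c) < wordWeight (j :: i :: c) := by
  have : (i : ℕ) < j := h
  simp only [wordWeight, List.length_cons]
  nlinarith

/-- The rank of a word: words are compared by length first, then by weight. -/
def wordRank {n : ℕ} {G : Type*} (x : List (Fin n) × G) : ℕ ×ₗ ℕ :=
  toLex (x.1.length, wordWeight x.1)

theorem wordRank_lt_of_length_lt {n : ℕ} {G : Type*} {x y : List (Fin n) × G}
    (h : x.1.length < y.1.length) : wordRank x < wordRank y :=
  Prod.Lex.toLex_lt_toLex.2 (Or.inl h)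

theorem wordRank_swap_lt {n : ℕ} {G : Type*} {i j : Fin n} (h : i < j) (a c : List (Fin n)) (g : G) :
    wordRank (a ++ i :: j :: c, g) < wordRank (a ++ j :: i :: c, g) :=
  Prod.Lex.toLex_lt_toLex.2 (Or.inr ⟨by simp, wordWeight_append_lt a (by simp) (wordWeight_swap h c)⟩)

variable {k G V : Type*} {n : ℕ} [Field k] [AddCommGroup V] [Module k V]
  (b : Module.Basis (Fin n) k V) [Group G] [DistribMulAction G V]
  {lam : MonoidAlgebra k G →ₗ[k] V →ₗ[k] MonoidAlgebra k G}
  {kap : V →ₗ[k] V →ₗ[k] MonoidAlgebra k G}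

/-- A descent is replaced by the swapped word, of equal length and smaller weight, plus a κ-term at
least two letters shorter. -/
theorem word_sub_rewriteRel_mem {x : List (Fin n) × G} {d : WordModule k G (Fin n)}
    (hd : d ∈ rewriteRel b lam kap x) :
    single x 1 - d ∈ supported k k {y | wordRank y < wordRank x} := by
  obtain ⟨a, j, i, c, g, hij, rfl, rfl⟩ := hd
  have e : (single (a ++ j :: i :: c, g) 1 : WordModule k G (Fin n)) =
      prefixOp b G a (vecOp b G (b j) (vecOp b G (b i) (word k c g))) := by
    rw [vecOp_basis_word, vecOp_basis_word, prefixOp_word]; rfl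
  rw [e, ← map_sub, wordRel_apply]
  simp only [LinearMap.sub_apply, Module.End.mul_apply, sub_sub_cancel, sub_sub,
    map_add]
  refine Submodule.add_mem _ ?_ ?_
  · rw [vecOp_basis_word, vecOp_basis_word, prefixOp_word]
    exact single_mem_supported k 1 (wordRank_swap_lt hij a c g)
  · have := prefixOp_mem_wordLE b a (algOp_mem_wordLE b lam (kap (b j) (b i))
      (word_mem_wordLE (k := k) (g := g) (le_refl c.length)))
    refine supported_mono (fun y hy => wordRank_lt_of_length_lt ?_) this
    simp only [Set.mem_ofPred_eq] at hy
    simp only [List.length_append, List.length_cons]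
    omega

variable (lam kap) in
/-- The span of the rewriting relations with leading word smaller than `x`. -/
noncomputable def rewriteRelLT (x : List (Fin n) × G) : Submodule k (WordModule k G (Fin n)) :=
  Submodule.span k {e | ∃ y, wordRank y < wordRank x ∧ e ∈ rewriteRel b lam kap y}

theorem commRel_mem_rewriteRelLT {x : List (Fin n) × G} {a : List (Fin n)} {j i : Fin n}
    {c : List (Fin n)} {g : G} (hij : i < j) (h : wordRank (a ++ j :: i :: c, g) < wordRank x) :
    prefixOp b G a (wordRel b lam kap (b j) (b i) (word k c g)) ∈
      rewriteRelLT b lam kap x :=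
  Submodule.subset_span ⟨_, h, a, j, i, c, g, hij, rfl, rfl⟩

/-- The vectors ᵍbᵢ are not basis vectors, so stability was proved for relations with arbitrary u
and v. Bilinearity and alternation, valid in every characteristic, reduce these to pairs of basis
vectors in descending order. -/
theorem relLE_le_span (hkap : ∀ v, kap v v = 0) (d : ℕ) : relLE b lam kap d ≤
    Submodule.span k {e | ∃ y : List (Fin n) × G, y.1.length ≤ d ∧ e ∈ rewriteRel b lam kap y} := by
  refine Submodule.span_le.2 ?_
  rintro _ ⟨a, u, v, c, hc, m, hm, rfl⟩
  change prefixOp b G a _ ∈ Submodule.span k _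
  rw [← b.sum_repr u, ← b.sum_repr v]
  simp only [map_sum, LinearMap.sum_apply, map_smul, LinearMap.smul_apply]
  refine Submodule.sum_mem _ fun i _ => Submodule.smul_mem _ _ ?_
  refine Submodule.sum_mem _ fun j _ => Submodule.smul_mem _ _ ?_
  refine map_wordLE_le (prefixOp b G a * wordRel b lam kap _ _) (fun l g hl => ?_) hm
  have hmem : ∀ s t : Fin n, t < s →
      prefixOp b G a (wordRel b lam kap (b s) (b t) (word k l g)) ∈ Submodule.span k
        {e | ∃ y : List (Fin n) × G, y.1.length ≤ d ∧ e ∈ rewriteRel b lam kap y} :=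
    fun s t hst => Submodule.subset_span ⟨(a ++ s :: t :: l, g),
      by simp only [List.length_append, List.length_cons]; omega, a, s, t, l, g, hst, rfl, rfl⟩
  rcases lt_trichotomy i j with h | h | h
  · exact hmem _ _ h
  · have : wordRel b lam kap (b j) (b i) = 0 := by rw [h]; exact commRel_self hkap _
    rw [this, mul_zero]
    exact Submodule.zero_mem _
  · have : wordRel b lam kap (b j) (b i) = - wordRel b lam kap (b i) (b j) :=
      commRel_neg hkap _ _
    rw [this, Module.End.mul_apply, LinearMap.neg_apply, map_neg]
    exact Submodule.neg_mem _ (hmem _ _ h)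

/-- Relations of degree below the length of `x` can thus be discarded without tracking their leading
words. -/
theorem relLE_le_rewriteRelLT (hkap : ∀ v, kap v v = 0) {x : List (Fin n) × G} {d : ℕ}
    (hd : d < x.1.length) : relLE b lam kap d ≤ rewriteRelLT b lam kap x :=
  (relLE_le_span b hkap d).trans <| Submodule.span_mono fun _ ⟨y, hy, he⟩ =>
    ⟨y, wordRank_lt_of_length_lt (hy.trans_lt hd), he⟩

section Hypotheses

variable [Fintype G] [SMulCommClass G k V] (hkap : ∀ v, kap v v = 0)
  (h1 : ∀ (g h : G) (v : V), lam (of k G (g * h)) v =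
    lam (of k G g) (h • v) * of k G h + of k G g * lam (of k G h) v)
  (h2 : ∀ (g : G) (u v : V), kap (g • u) (g • v) * of k G g - of k G g * kap u v =
    lam (lam (of k G g) v) u - lam (lam (of k G g) u) v)
  (h3 : ∀ (g h : G) (u v : V), (lam (of k G g) v).coeff h • (h • u - g • u) =
    (lam (of k G g) u).coeff h • (h • v - g • v))
  (h4 : ∀ (g : G) (u v w : V), (kap u v).coeff g • (g • w - w) + (kap v w).coeff g • (g • u - u) +
    (kap w u).coeff g • (g • v - v) = 0)
  (h5 : ∀ u v w : V, lam (kap u v) w + lam (kap v w) u + lam (kap w u) v = 0)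

-- The overlap ambiguity lji: `commRel_mul_sub_mul_commRel` writes it through four relations, whose
-- leading words all arise from lji by resolving descents.
include hkap h4 h5 in
theorem overlap_mem (a : List (Fin n)) {i j l : Fin n} (hij : i < j) (hjl : j < l)
    (c : List (Fin n)) (g : G) :
    prefixOp b G a (wordRel b lam kap (b l) (b j) (word k (i :: c) g)) -
      prefixOp b G (a ++ [l]) (wordRel b lam kap (b j) (b i) (word k c g)) ∈
      rewriteRelLT b lam kap (a ++ l :: j :: i :: c, g) := by
  have e : wordRel b lam kap (b l) (b j) * vecOp b G (b i) -
      vecOp b G (b l) * wordRel b lam kap (b j) (b i) =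
      vecOp b G (b i) * wordRel b lam kap (b l) (b j) -
      wordRel b lam kap (b j) (b i) * vecOp b G (b l) -
      vecOp b G (b j) * wordRel b lam kap (b l) (b i) +
      wordRel b lam kap (b l) (b i) * vecOp b G (b j) :=
    commRel_mul_sub_mul_commRel (algOp_mul_vecOp b lam) hkap h4 h5 _ _ _
  have e' := congrArg (prefixOp b G a) (LinearMap.congr_fun e (word k c g))
  simp only [LinearMap.sub_apply, LinearMap.add_apply, Module.End.mul_apply, map_sub, map_add,
    vecOp_basis_word] at e'
  have p : ∀ (s : Fin n) (m : WordModule k G (Fin n)),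
      prefixOp b G a (vecOp b G (b s) m) = prefixOp b G (a ++ [s]) m := by
    intro s m
    rw [prefixOp_append, Module.End.mul_apply]
    simp [prefixOp]
  simp only [p] at e'
  rw [e']
  have q : ∀ s t r : Fin n, (a ++ [s]) ++ t :: r :: c = a ++ s :: t :: r :: c := by simp
  have w1 : wordRank (a ++ l :: i :: j :: c, g) < wordRank (a ++ l :: j :: i :: c, g) := by
    simpa using wordRank_swap_lt hij (a ++ [l]) c g
  have w2 : wordRank (a ++ j :: l :: i :: c, g) < wordRank (a ++ l :: j :: i :: c, g) :=
    wordRank_swap_lt hjl a (i :: c) g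
  have w3 : wordRank (a ++ i :: l :: j :: c, g) < wordRank (a ++ l :: j :: i :: c, g) :=
    (wordRank_swap_lt (hij.trans hjl) a (j :: c) g).trans w1
  have w4 : wordRank (a ++ j :: i :: l :: c, g) < wordRank (a ++ l :: j :: i :: c, g) :=
    lt_trans (by simpa using wordRank_swap_lt (hij.trans hjl) (a ++ [j]) c g) w2
  refine Submodule.add_mem _ (Submodule.sub_mem _ (Submodule.sub_mem _ ?_ ?_) ?_) ?_
  · exact commRel_mem_rewriteRelLT b hjl (by rwa [q])
  · exact commRel_mem_rewriteRelLT b hij w4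
  · exact commRel_mem_rewriteRelLT b (hij.trans hjl) (by rwa [q])
  · exact commRel_mem_rewriteRelLT b (hij.trans hjl) w1

-- Expand each descent as its relation plus its reduced form. The product of the two relations is
-- common to both sides, and what remains is one relation next to the reduced form of the other
-- descent.
include hkap h1 h2 h3 in
theorem disjoint_mem (a : List (Fin n)) {i j i' j' : Fin n} (hij : i < j) (hij' : i' < j')
    (c c' : List (Fin n)) (g : G) :
    prefixOp b G a (wordRel b lam kap (b j) (b i)
        (word k (c ++ j' :: i' :: c') g)) -
      prefixOp b G (a ++ j :: i :: c)
        (wordRel b lam kap (b j') (b i') (word k c' g)) ∈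
      rewriteRelLT b lam kap (a ++ j :: i :: (c ++ j' :: i' :: c'), g) := by
  set D := wordRel b lam kap with hD
  have hlen : (a ++ j :: i :: (c ++ j' :: i' :: c')).length =
    a.length + c.length + c'.length + 4 := by
      simp only [List.length_append, List.length_cons]; omega
  have hw := word_mem_wordLE (k := k) (g := g) (le_refl c'.length)
  have e1 : word k (c ++ j' :: i' :: c') g = prefixOp b G c (D (b j') (b i') (word k c' g)) +
      (word k (c ++ i' :: j' :: c') g +
        prefixOp b G c (algOp b lam (kap (b j') (b i')) (word k c' g))) := by
    rw [hD, wordRel_apply]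
    simp only [LinearMap.sub_apply, Module.End.mul_apply, vecOp_basis_word, map_sub, prefixOp_word]
    abel
  have e2 : ∀ m, prefixOp b G (a ++ j :: i :: c) m =
      prefixOp b G a (D (b j) (b i) (prefixOp b G c m)) +
      (prefixOp b G (a ++ i :: j :: c) m +
        prefixOp b G a (algOp b lam (kap (b j) (b i)) (prefixOp b G c m))) := by
    intro m
    rw [hD, wordRel_apply]
    simp only [LinearMap.sub_apply, Module.End.mul_apply, map_sub, prefixOp_append, prefixOp_cons]
    abel
  -- The product of the two relations cancels here.
  rw [e1, e2, map_add, map_add, add_sub_add_left_eq_sub]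
  refine Submodule.sub_mem _ ?_ (Submodule.add_mem _ ?_ ?_)
  · rw [map_add, map_add]
    refine Submodule.add_mem _ (commRel_mem_rewriteRelLT b hij ?_) ?_
    · simpa using wordRank_swap_lt hij' (a ++ j :: i :: c) c' g
    · refine relLE_le_rewriteRelLT b hkap ?_ (prefixOp_commRel_mem_relLE b lam kap
        (prefixOp_mem_wordLE b c (algOp_mem_wordLE b lam (kap (b j') (b i')) hw)) le_rfl)
      rw [hlen]; omega
  · refine commRel_mem_rewriteRelLT b hij' ?_
    simpa using wordRank_swap_lt hij a (c ++ j' :: i' :: c') g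
  -- Here κ(j,i) ∈ kG stands to the left of the second relation; conditions 1-3 are what allow it to
  -- be pushed through.
  · refine relLE_le_rewriteRelLT b hkap ?_ (prefixOp_mem_relLE b lam kap a
      (algOp_mem_relLE b h1 h2 h3 (kap (b j) (b i)) (prefixOp_commRel_mem_relLE b lam kap hw le_rfl)))
    rw [hlen]; omega

-- The positions of two descents in a word differ by 0 (same relation), by 1 (overlap) or by at
-- least 2 (disjoint).
include hkap h1 h2 h3 h4 h5 in
theorem rewriteRel_sub_mem {x : List (Fin n) × G} {d d' : WordModule k G (Fin n)}
    (hd : d ∈ rewriteRel b lam kap x) (hd' : d' ∈ rewriteRel b lam kap x) :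
    d - d' ∈ rewriteRelLT b lam kap x := by
  obtain ⟨a, j, i, c, g, hij, rfl, rfl⟩ := hd
  obtain ⟨a', j', i', c', g', hij', hx', rfl⟩ := hd'
  obtain ⟨hx, rfl⟩ := Prod.mk.inj hx'
  clear hx'
  wlog hle : a.length ≤ a'.length generalizing a j i c a' j' i' c'
  · have := this a' j' i' c' hij' a j i c hij hx.symm (le_of_not_ge hle)
    rw [← neg_sub, hx]
    exact Submodule.neg_mem _ this
  obtain ⟨s, rfl⟩ : ∃ s, a' = a ++ s := by
    rcases List.append_eq_append_iff.1 hx with ⟨s, hs, -⟩ | ⟨s, hs, -⟩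
    · exact ⟨s, hs⟩
    · have : s = [] := by
        rw [hs, List.length_append] at hle
        exact List.length_eq_zero_iff.1 (by omega)
      exact ⟨[], by rw [hs, this, List.append_nil, List.append_nil]⟩
  rw [List.append_assoc, List.append_cancel_left_eq] at hx
  match s with
  | [] =>
    obtain ⟨rfl, rfl, rfl⟩ : j = j' ∧ i = i' ∧ c = c' := by simpa using hx
    rw [List.append_nil, sub_self]
    exact Submodule.zero_mem _
  | [t] =>
    obtain ⟨rfl, rfl, rfl⟩ : j = t ∧ i = j' ∧ c = i' :: c' := by simpa using hx
    exact overlap_mem b hkap h4 h5 a hij' hij c' g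
  | t :: t' :: s =>
    obtain ⟨rfl, rfl, rfl⟩ : j = t ∧ i = t' ∧ c = s ++ j' :: i' :: c' := by simpa using hx
    exact disjoint_mem b hkap h1 h2 h3 a hij hij' s c' g

include hkap h1 h2 h3 h4 h5 in
/-- The normal form map: it kills all relations, fixes sorted words and does not increase
lengths. -/
theorem exists_normalForm : ∃ N : WordModule k G (Fin n) →ₗ[k] WordModule k G (Fin n),
    (∀ d, relLE b lam kap d ≤ LinearMap.ker N) ∧
    (∀ l g, l.Pairwise (· ≤ ·) → N (word k l g) = word k l g) ∧
    (∀ d, ∀ m ∈ wordLE k G (Fin n) d, N m ∈ wordLE k G (Fin n) d) := by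
  have hS := fun x d (hd : d ∈ rewriteRel b lam kap x) => word_sub_rewriteRel_mem b hd
  refine ⟨linearCombination k (normalForm wordRank (rewriteRel b lam kap)), fun d => ?_,
    fun l g hl => ?_, fun d m hm => map_wordLE_le _ (fun l g hl => ?_) hm⟩
  · refine (relLE_le_span b hkap d).trans (Submodule.span_le.2 ?_)
    rintro e ⟨y, -, he⟩
    exact linearCombination_normalForm_eq_zero wordRank _ hS
      (fun x d hd d' hd' => rewriteRel_sub_mem b hkap h1 h2 h3 h4 h5 hd hd') y e he
  · rw [word, linearCombination_single, one_smul, normalForm_of_eq_empty]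
    -- A sorted word has no descent, so no relation has it as leading word.
    refine Set.eq_empty_of_forall_notMem ?_
    rintro _ ⟨a, j, i, c, g', hij, h, -⟩
    obtain ⟨rfl, rfl⟩ := Prod.mk.inj h
    have := (List.pairwise_append.1 hl).2.1
    exact absurd ((List.pairwise_cons.1 this).1 i (by simp)) (not_le_of_gt hij)
  · rw [word, linearCombination_single, one_smul]
    refine supported_mono (fun y hy => ?_) (normalForm_mem_supported wordRank _ hS (l, g))
    have : y.1.length ≤ l.length := by
      rcases Prod.Lex.toLex_le_toLex.1 hy with h | h
      · exact h.le
      · exact h.1.le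
    exact this.trans hl

end Hypotheses

end Confluence

/-! ### Maps out of S(V) into a noncommutative algebra -/

section SymmetricAlgebra

variable {k V A : Type*} [Field k] [AddCommGroup V] [Module k V] [Ring A] [Algebra k A]

/-- A linear map with commuting values extends to the symmetric algebra. -/
noncomputable def SymmetricAlgebra.liftOfCommute (f : V →ₗ[k] A)
    (hf : ∀ v w, f v * f w = f w * f v) : SymmetricAlgebra k V →ₐ[k] A :=
  RingCon.liftₐ _ (TensorAlgebra.lift k f) <| by
    refine RingCon.ringConGen_le.2 fun x y h => ?_
    induction h with | mul_comm v w
    rw [RingCon.ker_apply]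
    simp [hf v w]

theorem SymmetricAlgebra.liftOfCommute_ι (f : V →ₗ[k] A)
    (hf : ∀ v w, f v * f w = f w * f v) (v : V) :
    SymmetricAlgebra.liftOfCommute f hf (SymmetricAlgebra.ι k V v) = f v :=
  TensorAlgebra.lift_ι_apply f v

/-- Linear functionals on V extend to S(V), and they separate vectors. -/
theorem SymmetricAlgebra.ι_eq_zero {v : V} (h : SymmetricAlgebra.ι k V v = 0) : v = 0 := by
  refine (Module.forall_dual_apply_eq_zero_iff k v).1 fun φ => ?_
  rw [← SymmetricAlgebra.lift_ι_apply φ v, h, map_zero]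

end SymmetricAlgebra

/-! ### Symbols in the associated graded algebra -/

namespace AssocGraded

variable {k A : Type*} [Field k] [Ring A] [Algebra k A] (F : ℕ → Submodule k A)

/-- The linear map sending an element of `F n` to its symbol in the associated graded algebra. -/
noncomputable def symbol (n : ℕ) : F n →ₗ[k] DirectSum ℕ (Piece F) :=
  DirectSum.lof k ℕ (Piece F) n ∘ₗ proj F n

variable {F}

theorem symbol_mul [SetLike.GradedMonoid F] {i j : ℕ} (a : F i) (b : F j) :
    symbol F i a * symbol F j b =
      symbol F (i + j) ⟨a * b, SetLike.GradedMul.mul_mem a.2 b.2⟩ :=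
  DirectSum.of_mul_of _ _

/-- The degrees may differ by a propositional equality, because products of symbols land in degrees
of the form `i + j`. -/
theorem symbol_eq_of_sub_mem {m n : ℕ} (h : m = n) (a : F m) (b : F n)
    (hab : (a - b : A) ∈ below F n) : symbol F m a = symbol F n b := by
  subst h
  rw [← sub_eq_zero, ← map_sub]
  have : proj F m (a - b) = 0 := symb_eq_zero.2 hab
  rw [symbol, LinearMap.comp_apply, this, map_zero]

theorem symbol_congr {m n : ℕ} (h : m = n) (a : F m) (b : F n) (hab : (a : A) = b) :
    symbol F m a = symbol F n b :=
  symbol_eq_of_sub_mem h a b (by rw [hab, sub_self]; exact Submodule.zero_mem _)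

theorem symbol_eq_zero_iff {n : ℕ} (a : F n) : symbol F n a = 0 ↔ (a : A) ∈ below F n := by
  rw [← symb_eq_zero (ha := a.2), symbol, LinearMap.comp_apply, DirectSum.lof_eq_of,
    map_eq_zero_iff _ (DirectSum.of_injective n)]
  rfl

theorem range_lof_eq_range_symbol (n : ℕ) :
    LinearMap.range (DirectSum.lof k ℕ (Piece F) n) = LinearMap.range (symbol F n) := by
  rw [symbol, LinearMap.range_comp_of_range_eq_top]
  exact LinearMap.range_eq_top.2 (Submodule.mkQ_surjective _)

end AssocGraded

/-! ### The canonical surjection S(V) # G → gr H -/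

namespace Hecke

open MonoidAlgebra (of)

variable {k G V : Type*} [Field k] [Group G] [AddCommGroup V] [Module k V] [DistribMulAction G V]
  (lam : MonoidAlgebra k G →ₗ[k] V →ₗ[k] MonoidAlgebra k G)
  (kap : V →ₗ[k] V →ₗ[k] MonoidAlgebra k G)

/-- The canonical map `V → H_{λ,κ}`. -/
noncomputable def ofVec : V →ₗ[k] Hecke lam kap where
  toFun v := gen lam kap (Sum.inl v)
  map_add' v w := (RingQuot.mkAlgHom_rel k (Rel.vec_add v w)).trans (map_add _ _ _)
  map_smul' c v := (RingQuot.mkAlgHom_rel k (Rel.vec_smul c v)).trans (map_smul _ _ _)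

theorem ofVec_apply (v : V) : ofVec lam kap v = gen lam kap (Sum.inl v) := rfl

/-- The canonical map `kG → H_{λ,κ}`. -/
noncomputable def ofAlg : MonoidAlgebra k G →ₐ[k] Hecke lam kap :=
  MonoidAlgebra.lift k (Hecke lam kap) G
    { toFun := fun g => gen lam kap (Sum.inr g)
      map_one' := (RingQuot.mkAlgHom_rel k Rel.grp_one).trans (map_one _)
      map_mul' := fun g h => (RingQuot.mkAlgHom_rel k (Rel.grp_mul g h)).trans (map_mul _ _ _) }

theorem ofAlg_of (g : G) : ofAlg lam kap (of k G g) = gen lam kap (Sum.inr g) :=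
  MonoidAlgebra.lift_of _ _

theorem mkAlgHom_grpAlg (x : MonoidAlgebra k G) :
    RingQuot.mkAlgHom k (Rel lam kap) (grpAlg V x) = ofAlg lam kap x := by
  rw [grpAlg, ofAlg, MonoidAlgebra.lift_apply, map_finsuppSum]
  simp only [map_smul]
  rfl

theorem ofAlg_mul_ofVec (g : G) (v : V) : ofAlg lam kap (of k G g) * ofVec lam kap v =
    ofVec lam kap (g • v) * ofAlg lam kap (of k G g) + ofAlg lam kap (lam (of k G g) v) := by
  have := RingQuot.mkAlgHom_rel k (Rel.cross (lam := lam) (kap := kap) g v)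
  rw [mkAlgHom_grpAlg, map_sub, map_mul, map_mul, sub_eq_iff_eq_add'] at this
  rw [ofAlg_of]
  exact this

theorem ofVec_commRel (u v : V) :
    commRel kap (ofVec lam kap) (ofAlg lam kap).toLinearMap u v = 0 := by
  have := RingQuot.mkAlgHom_rel k (Rel.comm (lam := lam) (kap := kap) u v)
  rw [mkAlgHom_grpAlg, map_sub, map_mul, map_mul] at this
  rw [commRel_apply]
  exact sub_eq_zero.2 this

theorem ofVec_mem_filt (v : V) : ofVec lam kap v ∈ filt lam kap 1 :=
  Submodule.subset_span ⟨[Sum.inl v], by simp, by simp [ofVec_apply]⟩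

theorem gen_inr_mem_filt (g : G) : gen lam kap (Sum.inr g) ∈ filt lam kap 0 :=
  Submodule.subset_span ⟨[Sum.inr g], by simp, by simp⟩

theorem ofAlg_mem_filt (x : MonoidAlgebra k G) : ofAlg lam kap x ∈ filt lam kap 0 := by
  rw [ofAlg, MonoidAlgebra.lift_apply]
  exact Submodule.sum_mem _ fun g _ => Submodule.smul_mem _ _ (gen_inr_mem_filt lam kap g)

open AssocGraded

/-- The degree one part of the canonical map `V → gr H_{λ,κ}`. -/
noncomputable def grVec : V →ₗ[k] AssocGraded (filt lam kap) :=
  symbol (filt lam kap) 1 ∘ₗ (ofVec lam kap).codRestrict _ (ofVec_mem_filt lam kap)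

/-- The canonical map `G → gr H_{λ,κ}`. -/
noncomputable def grGrp : G →* AssocGraded (filt lam kap) where
  toFun g := symbol (filt lam kap) 0 ⟨gen lam kap (Sum.inr g), gen_inr_mem_filt lam kap g⟩
  map_one' := symbol_congr (F := filt lam kap) rfl _ ⟨1, SetLike.GradedOne.one_mem⟩
    (show gen lam kap (Sum.inr 1) = 1 by rw [← ofAlg_of, map_one, map_one])
  map_mul' g h := by
    rw [symbol_mul]
    exact symbol_congr (F := filt lam kap) (by rfl) _ _ (by simp only [← ofAlg_of, map_mul])

/-- The commutator κ(v,w) has degree 0, so it vanishes in degree 2. -/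
theorem grVec_mul_comm (v w : V) :
    grVec lam kap v * grVec lam kap w = grVec lam kap w * grVec lam kap v := by
  simp only [grVec, LinearMap.comp_apply]
  rw [symbol_mul, symbol_mul]
  refine symbol_eq_of_sub_mem (F := filt lam kap) rfl _ _ ?_
  have := ofVec_commRel lam kap v w
  rw [commRel_apply, sub_eq_zero] at this
  change ofVec lam kap v * ofVec lam kap w - ofVec lam kap w * ofVec lam kap v ∈ _
  rw [this]
  exact le_below (filt lam kap) (by norm_num) (ofAlg_mem_filt lam kap _)

/-- The correction λ(g,v) has degree 0, so it vanishes in degree 1. -/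
theorem grGrp_mul_grVec (g : G) (v : V) :
    grGrp lam kap g * grVec lam kap v = grVec lam kap (g • v) * grGrp lam kap g := by
  simp only [grVec, LinearMap.comp_apply]
  change symbol _ 0 _ * _ = _ * symbol _ 0 _
  rw [symbol_mul, symbol_mul]
  refine symbol_eq_of_sub_mem (F := filt lam kap) rfl _ _ ?_
  have := ofAlg_mul_ofVec lam kap g v
  rw [← sub_eq_iff_eq_add', ofAlg_of] at this
  change gen lam kap (Sum.inr g) * ofVec lam kap v -
    ofVec lam kap (g • v) * gen lam kap (Sum.inr g) ∈ _
  rw [this]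
  exact le_below (filt lam kap) (by norm_num) (ofAlg_mem_filt lam kap _)

/-- The canonical map `S(V) → gr H_{λ,κ}`. -/
noncomputable def grSymm : SymmetricAlgebra k V →ₐ[k] AssocGraded (filt lam kap) :=
  SymmetricAlgebra.liftOfCommute (grVec lam kap) (grVec_mul_comm lam kap)

theorem grSymm_ι (v : V) : grSymm lam kap (SymmetricAlgebra.ι k V v) = grVec lam kap v :=
  SymmetricAlgebra.liftOfCommute_ι _ _ v

variable [SMulCommClass G k V]

theorem grSymm_smul_mul_grGrp (g : G) (x : SymmetricAlgebra k V) :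
    grSymm lam kap (g • x) * grGrp lam kap g = grGrp lam kap g * grSymm lam kap x := by
  induction x using SymmetricAlgebra.induction with
  | algebraMap r => rw [smul_algebraMap, AlgHom.commutes, Algebra.commutes]
  | ι v => rw [SkewSymm.smul_ι, grSymm_ι, grSymm_ι, grGrp_mul_grVec]
  | mul x y hx hy => rw [smul_mul', map_mul, map_mul, mul_assoc, hy, ← mul_assoc, hx, mul_assoc]
  | add x y hx hy => rw [smul_add, map_add, map_add, add_mul, mul_add, hx, hy]

/-- The canonical map `S(V) # G → gr H_{λ,κ}`. -/
noncomputable def skewToGr : SkewSymm k G V →ₐ[k] AssocGraded (filt lam kap) :=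
  SkewMonoidAlgebra.liftNCAlgHom (grSymm lam kap) (grGrp lam kap)
    (fun {x y} => grSymm_smul_mul_grGrp lam kap y x)

theorem skewToGr_single (g : G) (s : SymmetricAlgebra k V) :
    skewToGr lam kap (SkewMonoidAlgebra.single g s) = grSymm lam kap s * grGrp lam kap g :=
  SkewMonoidAlgebra.liftNC_single _ _ _ _

variable (k G V) in
/-- The generator of `S(V) # G` attached to a vector or a group element. -/
noncomputable def skewGen : V ⊕ G → SkewSymm k G V
  | Sum.inl v => SkewMonoidAlgebra.single 1 (SymmetricAlgebra.ι k V v)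
  | Sum.inr g => SkewMonoidAlgebra.single g 1

theorem skewGen_prod_mem_component (l : List (V ⊕ G)) :
    (l.map (skewGen k G V)).prod ∈ SkewSymm.component k G V (l.countP Sum.isLeft) := by
  induction l with
  | nil =>
    classical
    intro g
    rw [List.map_nil, List.prod_nil, SkewMonoidAlgebra.coeff_one, List.countP_nil, pow_zero,
      Finsupp.single_apply]
    split_ifs
    · exact Submodule.one_le.1 le_rfl
    · exact Submodule.zero_mem _
  | cons s l ih =>
    rw [List.map_cons, List.prod_cons]
    cases s with
    | inl v =>
      rw [List.countP_cons_of_pos (by rfl)]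
      intro g
      rw [skewGen, SkewMonoidAlgebra.coeff_single_one_mul, pow_succ']
      exact Submodule.mul_mem_mul ⟨v, rfl⟩ (ih g)
    | inr h =>
      rw [List.countP_cons_of_neg (by simp)]
      intro g
      rw [skewGen, SkewMonoidAlgebra.coeff_single_mul, one_mul]
      have hle : LinearMap.range (SymmetricAlgebra.ι k V) ≤
          (LinearMap.range (SymmetricAlgebra.ι k V)).comap (SkewSymm.act k G V h).toLinearMap := by
        rintro _ ⟨v, rfl⟩
        exact ⟨h • v, (SkewSymm.smul_ι k G V h v).symm⟩
      have hmem := Submodule.mem_map_of_mem (f := (SkewSymm.act k G V h).toLinearMap)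
        (ih (h⁻¹ * g))
      rw [Submodule.map_pow] at hmem
      exact pow_le_pow_left' (Submodule.map_le_iff_le_comap.2 hle) _ hmem

/-- Gives surjectivity: the filtration is spanned by products of generators, and the symbol of each,
taken in degree its number of vectors, is the image of the same product in S(V) # G. -/
theorem skewToGr_skewGen_prod (l : List (V ⊕ G)) (h : (l.map (gen lam kap)).prod ∈
      filt lam kap (l.countP Sum.isLeft)) :
    skewToGr lam kap (l.map (skewGen k G V)).prod =
      symbol (filt lam kap) (l.countP Sum.isLeft) ⟨(l.map (gen lam kap)).prod, h⟩ := by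
  induction l with
  | nil =>
    rw [List.map_nil, List.prod_nil, map_one]
    rfl
  | cons s l ih =>
    have hl : (l.map (gen lam kap)).prod ∈ filt lam kap (l.countP Sum.isLeft) :=
      Submodule.subset_span ⟨l, le_rfl, rfl⟩
    rw [List.map_cons, List.prod_cons, map_mul, ih hl]
    cases s with
    | inl v =>
      rw [skewGen, skewToGr_single, map_one, mul_one, grSymm_ι, grVec, LinearMap.comp_apply,
        symbol_mul]
      exact symbol_congr (F := filt lam kap) (by
        rw [List.countP_cons_of_pos (by rfl), add_comm]) _ _ (by simp [ofVec_apply])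
    | inr g =>
      rw [skewGen, skewToGr_single, map_one, one_mul]
      change symbol _ 0 _ * _ = _
      rw [symbol_mul]
      exact symbol_congr (F := filt lam kap) (by
        rw [List.countP_cons_of_neg (by simp), zero_add]) _ _ (by simp)

theorem symbol_mem_map_skewToGr (n : ℕ) (a : filt lam kap n) :
    symbol (filt lam kap) n a ∈
      (SkewSymm.component k G V n).map (skewToGr lam kap).toLinearMap := by
  obtain ⟨a, ha⟩ := a
  induction ha using Submodule.span_induction with
  | mem a h =>
    obtain ⟨l, hl, rfl⟩ := h
    rcases hl.lt_or_eq with h | rfl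
    -- A product with fewer than `n` vectors already lies in a lower level.
    · have : symbol (filt lam kap) n ⟨_, Submodule.subset_span ⟨l, hl, rfl⟩⟩ = 0 :=
        (symbol_eq_zero_iff (F := filt lam kap) _).2
          (le_below (filt lam kap) h (Submodule.subset_span ⟨l, le_rfl, rfl⟩))
      rw [this]
      exact Submodule.zero_mem _
    · exact ⟨_, skewGen_prod_mem_component l, skewToGr_skewGen_prod lam kap l _⟩
  | zero =>
    have : (⟨0, Submodule.zero_mem _⟩ : filt lam kap n) = 0 := rfl
    rw [this, map_zero]
    exact Submodule.zero_mem _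
  | add a b ha hb iha ihb =>
    have : (⟨a + b, Submodule.add_mem _ ha hb⟩ : filt lam kap n) = ⟨a, ha⟩ + ⟨b, hb⟩ := rfl
    rw [this, map_add]
    exact Submodule.add_mem _ iha ihb
  | smul c a ha iha =>
    have : (⟨c • a, Submodule.smul_mem _ c ha⟩ : filt lam kap n) = c • ⟨a, ha⟩ := rfl
    rw [this, map_smul]
    exact Submodule.smul_mem _ _ iha

omit [SMulCommClass G k V] in
theorem grSymm_mem_range {n : ℕ} {s : SymmetricAlgebra k V}
    (hs : s ∈ LinearMap.range (SymmetricAlgebra.ι k V) ^ n) :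
    grSymm lam kap s ∈ LinearMap.range (symbol (filt lam kap) n) := by
  induction hs using Submodule.pow_induction_on_left' with
  | algebraMap r =>
    rw [AlgHom.commutes, Algebra.algebraMap_eq_smul_one]
    exact Submodule.smul_mem _ _ ⟨⟨1, SetLike.GradedOne.one_mem⟩, rfl⟩
  | add x y i hx hy ihx ihy => rw [map_add]; exact Submodule.add_mem _ ihx ihy
  | mem_mul m hm i x hx ih =>
    obtain ⟨v, rfl⟩ := hm
    obtain ⟨a, ha⟩ := ih
    rw [map_mul, grSymm_ι, ← ha, grVec, LinearMap.comp_apply, symbol_mul]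
    have h : ofVec lam kap v * a ∈ filt lam kap (i + 1) := by
      rw [add_comm]
      exact SetLike.GradedMul.mul_mem (ofVec_mem_filt lam kap v) a.2
    exact ⟨⟨_, h⟩, symbol_congr (F := filt lam kap) (add_comm 1 i).symm _ _ rfl⟩

theorem map_skewToGr_component (n : ℕ) :
    (SkewSymm.component k G V n).map (skewToGr lam kap).toLinearMap =
      LinearMap.range (DirectSum.lof k ℕ (Piece (filt lam kap)) n) := by
  rw [range_lof_eq_range_symbol]
  refine le_antisymm ?_ ?_
  · rintro _ ⟨f, hf, rfl⟩
    rw [← SkewMonoidAlgebra.sum_single f, SkewMonoidAlgebra.sum_def, Finsupp.sum, map_sum]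
    refine Submodule.sum_mem _ fun g _ => ?_
    rw [AlgHom.toLinearMap_apply, skewToGr_single]
    obtain ⟨a, ha⟩ := grSymm_mem_range lam kap (hf g)
    rw [← ha]
    change _ * symbol _ 0 _ ∈ _
    rw [symbol_mul]
    exact ⟨_, rfl⟩
  · rintro _ ⟨a, rfl⟩
    exact symbol_mem_map_skewToGr lam kap n a

theorem skewToGr_surjective : Function.Surjective (skewToGr lam kap) := by
  intro x
  induction x using DirectSum.induction_on with
  | zero => exact ⟨0, map_zero _⟩
  | of n x =>
    have : DirectSum.of _ n x ∈ (SkewSymm.component k G V n).map (skewToGr lam kap).toLinearMap := by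
      rw [map_skewToGr_component]
      exact ⟨x, rfl⟩
    obtain ⟨f, -, hf⟩ := this
    exact ⟨f, hf⟩
  | add x y hx hy =>
    obtain ⟨f, rfl⟩ := hx
    obtain ⟨f', rfl⟩ := hy
    exact ⟨f + f', map_add _ _ _⟩

/-- If the canonical map `S(V) # G → gr H_{λ,κ}` is injective, then the PBW property holds. -/
theorem pbw_of_injective (h : Function.Injective (skewToGr lam kap)) : PBW lam kap := by
  refine ⟨(AlgEquiv.ofBijective (skewToGr lam kap) ⟨h, skewToGr_surjective lam kap⟩).symm,
    fun n => ?_⟩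
  rw [← map_skewToGr_component, ← Submodule.map_comp]
  convert Submodule.map_id _
  refine LinearMap.ext fun f => ?_
  exact (AlgEquiv.ofBijective (skewToGr lam kap)
    ⟨h, skewToGr_surjective lam kap⟩).symm_apply_apply f

instance finite_component [Finite G] [FiniteDimensional k V] (n : ℕ) :
    Module.Finite k (SkewSymm.component k G V n) := by
  have : Module.Finite k ↥(LinearMap.range (SymmetricAlgebra.ι k V) ^ n) :=
    Module.Finite.iff_fg.2 (Submodule.FG.pow (Module.Finite.iff_fg.1 inferInstance) n)
  let c : SkewSymm.component k G V n →ₗ[k] G → ↥(LinearMap.range (SymmetricAlgebra.ι k V) ^ n) :=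
    { toFun := fun f g => ⟨f.1.coeff g, f.2 g⟩
      map_add' := fun f f' => funext fun g => Subtype.ext
        (DFunLike.congr_fun (SkewMonoidAlgebra.coeff_add f.1 f'.1) g)
      map_smul' := fun a f => funext fun g => Subtype.ext
        (DFunLike.congr_fun (SkewMonoidAlgebra.coeff_smul a f.1) g) }
  refine Module.Finite.of_injective c fun f f' h => Subtype.ext (SkewMonoidAlgebra.ext fun g => ?_)
  exact congrArg Subtype.val (congrFun h g)

/-- If the PBW property holds, then the canonical map `S(V) # G → gr H_{λ,κ}` is injective on
homogeneous elements. -/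
theorem PBW.eq_zero_of_skewToGr_eq_zero [Finite G] [FiniteDimensional k V] (h : PBW lam kap)
    {n : ℕ} {f : SkewSymm k G V} (hf : f ∈ SkewSymm.component k G V n)
    (h0 : skewToGr lam kap f = 0) : f = 0 := by
  obtain ⟨e, he⟩ := h
  have hmap : (SkewSymm.component k G V n).map (e.toLinearMap ∘ₗ (skewToGr lam kap).toLinearMap) =
      SkewSymm.component k G V n := by
    rw [Submodule.map_comp, map_skewToGr_component, he]
  -- The isomorphism `e` need not be inverse to the canonical map. Still, their composite maps the
  -- degree `n` component onto itself, and a surjective endomorphism of a finite-dimensional space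
  -- is injective.
  let φ : Module.End k (SkewSymm.component k G V n) :=
    (e.toLinearMap ∘ₗ (skewToGr lam kap).toLinearMap).restrict
      (fun x hx => hmap ▸ Submodule.mem_map_of_mem hx)
  have hφ : Function.Surjective φ := by
    rintro ⟨y, hy⟩
    rw [← hmap] at hy
    obtain ⟨x, hx, rfl⟩ := hy
    exact ⟨⟨x, hx⟩, rfl⟩
  have hi := OrzechProperty.injective_of_surjective_endomorphism φ hφ
  have : φ ⟨f, hf⟩ = 0 := Subtype.ext (show e (skewToGr lam kap f) = 0 by rw [h0, map_zero])
  exact congrArg Subtype.val ((map_eq_zero_iff φ hi).1 this)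

end Hecke

/-! ### Necessity of the five conditions -/

theorem AssocGraded.sum_symbol_eq_zero_iff {k A ι : Type*} [Field k] [Ring A] [Algebra k A]
    {F : ℕ → Submodule k A} {n : ℕ} (s : Finset ι) (a : ι → F n) :
    ∑ i ∈ s, symbol F n (a i) = 0 ↔ ∑ i ∈ s, (a i : A) ∈ below F n := by
  rw [← map_sum, symbol_eq_zero_iff, Submodule.coe_sum]

namespace Hecke

open MonoidAlgebra (of)
open AssocGraded

section Necessity

variable {k G V : Type*} [Field k] [Group G] [AddCommGroup V] [Module k V] [DistribMulAction G V]
  [SMulCommClass G k V]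
  {lam : MonoidAlgebra k G →ₗ[k] V →ₗ[k] MonoidAlgebra k G}
  {kap : V →ₗ[k] V →ₗ[k] MonoidAlgebra k G}

omit [Group G] [DistribMulAction G V] [SMulCommClass G k V] in
theorem coeff_sum_single [Fintype G] (s : G → SymmetricAlgebra k V) (h : G) :
    (∑ g, SkewMonoidAlgebra.single g (s g)).coeff h = s h := by
  classical
  have := map_sum SkewMonoidAlgebra.coeffAddEquiv
    (fun g => SkewMonoidAlgebra.single g (s g)) Finset.univ
  refine (DFunLike.congr_fun this h).trans ?_
  rw [Finsupp.finsetSum_apply]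
  simp [Finsupp.single_apply]

theorem PBW.sum_single_eq_zero [Fintype G] [FiniteDimensional k V] (hP : PBW lam kap) {n : ℕ}
    {s : G → SymmetricAlgebra k V}
    (hs : ∀ g, s g ∈ LinearMap.range (SymmetricAlgebra.ι k V) ^ n)
    (h0 : ∑ g, grSymm lam kap (s g) * grGrp lam kap g = 0) (g : G) : s g = 0 := by
  have h : ∑ g, SkewMonoidAlgebra.single g (s g) = (0 : SkewSymm k G V) := by
    refine hP.eq_zero_of_skewToGr_eq_zero lam kap (n := n) (fun g => ?_) ?_
    · rw [coeff_sum_single]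
      exact hs g
    · rw [map_sum, ← h0]
      exact Finset.sum_congr rfl fun g _ => skewToGr_single lam kap g (s g)
  rw [← coeff_sum_single s, h]
  rfl

omit [SMulCommClass G k V] in
theorem ofVec_mul_ofAlg_mem_filt (v : V) (x : MonoidAlgebra k G) :
    ofVec lam kap v * ofAlg lam kap x ∈ filt lam kap 1 := by
  have := SetLike.GradedMul.mul_mem (ofVec_mem_filt lam kap v) (ofAlg_mem_filt lam kap x)
  rwa [add_zero] at this

omit [SMulCommClass G k V] in
theorem grSymm_ι_mul_grGrp (v : V) (g : G) :
    grSymm lam kap (SymmetricAlgebra.ι k V v) * grGrp lam kap g =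
      symbol (filt lam kap) 1 ⟨_, ofVec_mul_ofAlg_mem_filt v (of k G g)⟩ := by
  rw [grSymm_ι, grVec, LinearMap.comp_apply]
  refine (symbol_mul (F := filt lam kap) _ ⟨_, gen_inr_mem_filt lam kap g⟩).trans ?_
  refine symbol_congr (F := filt lam kap) (add_zero 1) _ _ ?_
  change ofVec lam kap v * gen lam kap (Sum.inr g) = ofVec lam kap v * ofAlg lam kap (of k G g)
  rw [ofAlg_of]

omit [SMulCommClass G k V] in
theorem grSymm_algebraMap_mul_grGrp (c : k) (g : G) :
    grSymm lam kap (algebraMap k _ c) * grGrp lam kap g =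
      symbol (filt lam kap) 0 (c • ⟨_, gen_inr_mem_filt lam kap g⟩) := by
  rw [AlgHom.commutes, ← Algebra.smul_def, map_smul]
  rfl

/-- Under the PBW property, the elements `v g` and `g` are independent. -/
theorem PBW.eq_zero_of_sum_eq_zero [Fintype G] [FiniteDimensional k V] (hP : PBW lam kap)
    {w : G → V} {x : MonoidAlgebra k G}
    (h0 : ∑ g, ofVec lam kap (w g) * ofAlg lam kap (of k G g) + ofAlg lam kap x = 0) :
    (∀ g, w g = 0) ∧ x = 0 := by
  have hw : ∀ g, w g = 0 := by
    refine fun g => SymmetricAlgebra.ι_eq_zero (hP.sum_single_eq_zero (n := 1)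
      (s := fun g => SymmetricAlgebra.ι k V (w g))
      (fun g => by rw [pow_one]; exact ⟨_, rfl⟩) ?_ g)
    refine (Finset.sum_congr rfl fun g _ => grSymm_ι_mul_grGrp (w g) g).trans ?_
    refine (sum_symbol_eq_zero_iff (F := filt lam kap) _ _).2 ?_
    -- The degree-one part equals -x, which lies in level 0, so its symbol in degree 1 is zero. Once
    -- it is removed, x itself is tested in degree 0.
    rw [eq_neg_of_add_eq_zero_left h0]
    exact Submodule.neg_mem _ (le_below (filt lam kap) one_pos (ofAlg_mem_filt lam kap x))
  refine ⟨hw, ?_⟩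
  have hx : ofAlg lam kap x = 0 := by simpa [hw] using h0
  ext g
  refine (SymmetricAlgebra.algebraMap_eq_zero_iff V _).1 (hP.sum_single_eq_zero (n := 0)
    (s := fun g => algebraMap k _ (x.coeff g))
    (fun g => by rw [pow_zero]; exact Submodule.algebraMap_mem _) ?_ g)
  refine (Finset.sum_congr rfl fun g _ => grSymm_algebraMap_mul_grGrp (x.coeff g) g).trans ?_
  refine (sum_symbol_eq_zero_iff (F := filt lam kap) _ _).2 ?_
  have h2 : ∑ g, x.coeff g • gen lam kap (Sum.inr g) = 0 := by
    rw [← hx]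
    refine Eq.symm ((MonoidAlgebra.map_eq_sum_coeff_smul (ofAlg lam kap).toLinearMap x).trans ?_)
    exact Finset.sum_congr rfl fun g _ => congrArg _ (ofAlg_of lam kap g)
  exact (congrArg (· ∈ below (filt lam kap) 0) h2).mpr (Submodule.zero_mem _)

/-- In H all commutator relations vanish, so `mul_commRel_sub_commRel_mul` and `commRel_jacobi`
become linear relations among the vg and g, whose coefficients must be zero. Condition 1 compares
two ways of moving gh past v. -/
theorem PBW.conditions [Fintype G] [FiniteDimensional k V] (hP : PBW lam kap) :
    (∀ (g h : G) (v : V), lam (of k G (g * h)) v =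
      lam (of k G g) (h • v) * of k G h + of k G g * lam (of k G h) v) ∧
    (∀ (g : G) (u v : V), kap (g • u) (g • v) * of k G g - of k G g * kap u v =
      lam (lam (of k G g) v) u - lam (lam (of k G g) u) v) ∧
    (∀ (g h : G) (u v : V), (lam (of k G g) v).coeff h • (h • u - g • u) =
      (lam (of k G g) u).coeff h • (h • v - g • v)) ∧
    (∀ (g : G) (u v w : V), (kap u v).coeff g • (g • w - w) + (kap v w).coeff g • (g • u - u) +
      (kap w u).coeff g • (g • v - v) = 0) ∧
    (∀ u v w : V, lam (kap u v) w + lam (kap v w) u + lam (kap w u) v = 0) := by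
  have h23 := fun g u v => hP.eq_zero_of_sum_eq_zero <| Eq.symm <| by
    have := mul_commRel_sub_commRel_mul (kap := kap) (ofAlg_mul_ofVec lam kap) g u v
    rw [ofVec_commRel, ofVec_commRel, mul_zero, zero_mul, sub_zero] at this
    exact this
  have h45 := fun u v w => hP.eq_zero_of_sum_eq_zero <| Eq.symm <| by
    have := commRel_jacobi (kap := kap) (L := (ofAlg lam kap).toLinearMap)
      (ofAlg_mul_ofVec lam kap) u v w
    simp only [ofVec_commRel, mul_zero, zero_mul, sub_zero, add_zero] at this
    exact this
  refine ⟨fun g h v => ?_, fun g u v => sub_eq_zero.1 (h23 g u v).2, fun g h u v => ?_,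
    fun g u v w => (h45 u v w).1 g, fun u v w => (h45 u v w).2⟩
  · refine sub_eq_zero.1 (hP.eq_zero_of_sum_eq_zero (w := 0) ?_).2
    have e1 := ofAlg_mul_ofVec lam kap (g * h) v
    have e2 := ofAlg_mul_ofVec lam kap g (h • v)
    have e3 := ofAlg_mul_ofVec lam kap h v
    rw [map_mul, map_mul, mul_assoc, e3, mul_add, ← mul_assoc, e2, add_mul, mul_assoc, mul_smul,
      add_assoc] at e1
    -- The terms with (gh)v on the left agree; only the corrections in kG remain.
    have e4 := add_left_cancel e1
    simp only [Pi.zero_apply, map_zero, zero_mul, Finset.sum_const_zero, zero_add, map_sub,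
      map_add, map_mul] at e4 ⊢
    rw [e4, sub_self]
  · have := sub_eq_zero.1 ((h23 g u v).1 h)
    rw [← neg_sub (g • u), ← neg_sub (g • v), smul_neg, smul_neg, this]

end Necessity

end Hecke

/-! ### Sufficiency: a criterion for injectivity of the canonical map -/

namespace Hecke

open MonoidAlgebra (of)
open AssocGraded Finsupp

variable {k G V : Type*} [Field k] [Group G] [AddCommGroup V] [Module k V] [DistribMulAction G V]

section Spanning

variable {n : ℕ} (b : Module.Basis (Fin n) k V)

/-- The product in `S(V)` of the basis vectors indexed by a word. -/
noncomputable def symmMonomial (l : List (Fin n)) : SymmetricAlgebra k V :=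
  (l.map fun i => SymmetricAlgebra.ι k V (b i)).prod

/-- A monomial may be sorted because S(V) is commutative. Only spanning is needed: independence of
sorted monomials is supplied by the words in `skewToGr_injective`. -/
theorem span_symmMonomial_eq_top :
    Submodule.span k (symmMonomial b '' {l | l.Pairwise (· ≤ ·)}) = ⊤ := by
  refine eq_top_iff.2 fun x hx => ?_
  clear hx
  induction x using SymmetricAlgebra.induction with
  | algebraMap r =>
    rw [Algebra.algebraMap_eq_smul_one]
    exact Submodule.smul_mem _ _ (Submodule.subset_span ⟨[], by simp, by simp [symmMonomial]⟩)
  | ι v =>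
    rw [← b.sum_repr v, map_sum]
    refine Submodule.sum_mem _ fun i _ => ?_
    rw [map_smul]
    exact Submodule.smul_mem _ _ (Submodule.subset_span ⟨[i], by simp, by simp [symmMonomial]⟩)
  | mul x y hx hy =>
    have h := Submodule.mul_mem_mul hx hy
    rw [Submodule.span_mul_span] at h
    refine Submodule.span_mono ?_ h
    rintro _ ⟨_, ⟨l, -, rfl⟩, _, ⟨l', -, rfl⟩, rfl⟩
    refine ⟨(l ++ l').insertionSort (· ≤ ·), List.pairwise_insertionSort _ _, ?_⟩
    rw [symmMonomial, ((List.perm_insertionSort (· ≤ ·) (l ++ l')).map _).prod_eq]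
    simp [symmMonomial]
  | add x y hx hy => exact Submodule.add_mem _ hx hy

/-- The element `v₁ ⋯ vₘ g` of `S(V) # G` attached to a word in the basis and a group element. -/
noncomputable def skewMonomial [SMulCommClass G k V] (p : List (Fin n) × G) : SkewSymm k G V :=
  SkewMonoidAlgebra.single p.2 (symmMonomial b p.1)

theorem exists_linearCombination_skewMonomial [SMulCommClass G k V] (f : SkewSymm k G V) :
    ∃ c ∈ supported k k {p : List (Fin n) × G | p.1.Pairwise (· ≤ ·)},
      linearCombination k (skewMonomial b) c = f := by
  rw [← mem_span_image_iff_linearCombination, ← SkewMonoidAlgebra.sum_single f,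
    SkewMonoidAlgebra.sum_def]
  refine Submodule.sum_mem _ fun g _ => ?_
  generalize f.coeff g = s
  have hs : s ∈ Submodule.span k (symmMonomial b '' {l | l.Pairwise (· ≤ ·)}) := by
    rw [span_symmMonomial_eq_top]; trivial
  induction hs using Submodule.span_induction with
  | mem s h =>
    obtain ⟨l, hl, rfl⟩ := h
    exact Submodule.subset_span ⟨(l, g), hl, rfl⟩
  | zero => rw [SkewMonoidAlgebra.single_zero]; exact Submodule.zero_mem _
  | add s t _ _ hs ht => rw [SkewMonoidAlgebra.single_add]; exact Submodule.add_mem _ hs ht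
  | smul c s _ hs => rw [← SkewMonoidAlgebra.smul_single]; exact Submodule.smul_mem _ c hs

variable (lam : MonoidAlgebra k G →ₗ[k] V →ₗ[k] MonoidAlgebra k G)
  (kap : V →ₗ[k] V →ₗ[k] MonoidAlgebra k G)

/-- The generators whose product is the monomial `v₁ ⋯ vₘ g`. -/
noncomputable def monomialGens (p : List (Fin n) × G) : List (V ⊕ G) :=
  p.1.map (fun i => Sum.inl (b i)) ++ [Sum.inr p.2]

omit [Group G] [DistribMulAction G V] in
theorem countP_monomialGens (p : List (Fin n) × G) :
    (monomialGens b p).countP Sum.isLeft = p.1.length := by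
  rw [monomialGens, List.countP_append, List.countP_map]
  simp [Function.comp_def]

/-- The element `v₁ ⋯ vₘ g` of `H_{λ,κ}` attached to a word in the basis and a group element. -/
noncomputable def monomial (p : List (Fin n) × G) : Hecke lam kap :=
  ((monomialGens b p).map (gen lam kap)).prod

theorem monomial_mem_filt (p : List (Fin n) × G) :
    monomial b lam kap p ∈ filt lam kap p.1.length :=
  Submodule.subset_span ⟨_, (countP_monomialGens b p).le, rfl⟩

theorem skewGen_prod_monomialGens [SMulCommClass G k V] (p : List (Fin n) × G) :
    ((monomialGens b p).map (skewGen k G V)).prod = skewMonomial b p := by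
  obtain ⟨l, g⟩ := p
  rw [monomialGens, skewMonomial, symmMonomial, List.map_append, List.prod_append]
  induction l with
  | nil => simp [skewGen]
  | cons i l ih =>
    simp only [List.map_cons, List.prod_cons, mul_assoc] at ih ⊢
    rw [ih, skewGen, SkewMonoidAlgebra.single_mul_single, one_mul, one_smul]

theorem skewToGr_skewMonomial [SMulCommClass G k V] (p : List (Fin n) × G) :
    skewToGr lam kap (skewMonomial b p) =
      symbol (filt lam kap) p.1.length ⟨_, monomial_mem_filt b lam kap p⟩ := by
  rw [← skewGen_prod_monomialGens, skewToGr_skewGen_prod lam kap _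
    (Submodule.subset_span ⟨_, le_rfl, rfl⟩)]
  exact symbol_congr (F := filt lam kap) (countP_monomialGens b p) _ _ rfl

/-- If some filtered linear map sends sorted monomials to the corresponding words, then the
canonical map `S(V) # G → gr H_{λ,κ}` is injective. -/
theorem skewToGr_injective [SMulCommClass G k V]
    (Θ : Hecke lam kap →ₗ[k] WordModule k G (Fin n))
    (hΘ : ∀ d, ∀ a ∈ filt lam kap d, Θ a ∈ wordLE k G (Fin n) d)
    (hmon : ∀ l g, l.Pairwise (· ≤ ·) → Θ (monomial b lam kap (l, g)) = word k l g) :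
    Function.Injective (skewToGr lam kap) := by
  refine (injective_iff_map_eq_zero _).2 fun f hf => ?_
  obtain ⟨c, hc, rfl⟩ := exists_linearCombination_skewMonomial b f
  suffices h : c = 0 by rw [h, map_zero]
  ext p₀
  by_contra hp₀
  set d := p₀.1.length with hd
  -- Only the degree `d` component is examined, so monomials of other lengths are replaced by 0. Any
  -- `p₀` with nonzero coefficient will do.
  let u : List (Fin n) × G → filt lam kap d := fun p =>
    if h : p.1.length = d then ⟨monomial b lam kap p, h ▸ monomial_mem_filt b lam kap p⟩ else 0
  have hu : ∀ p, DirectSum.component k ℕ (Piece (filt lam kap)) d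
      (skewToGr lam kap (skewMonomial b p)) = proj (filt lam kap) d (u p) := by
    intro p
    rw [skewToGr_skewMonomial]
    by_cases h : p.1.length = d
    · have e : symbol (filt lam kap) p.1.length ⟨_, monomial_mem_filt b lam kap p⟩ =
          symbol (filt lam kap) d (u p) :=
        symbol_congr (F := filt lam kap) h _ _ (by simp only [u, dif_pos h])
      rw [e]
      exact DirectSum.component.lof_self k d _
    · simp only [u, dif_neg h, map_zero]
      exact (DirectSum.component.of k d _ _).trans (dif_neg h)
  have h1 : proj (filt lam kap) d (∑ p ∈ c.support, c p • u p) = 0 := by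
    rw [map_sum, ← map_zero (DirectSum.component k ℕ (Piece (filt lam kap)) d), ← hf,
      linearCombination_apply, Finsupp.sum, map_sum, map_sum]
    simp only [map_smul, hu]
  have h2 : ((∑ p ∈ c.support, c p • u p : filt lam kap d) : Hecke lam kap) ∈
      below (filt lam kap) d := symb_eq_zero.1 h1
  have h3 : below (filt lam kap) d ≤
      (supported k k {p : List (Fin n) × G | p.1.length < d}).comap Θ :=
    below_le_iff.2 fun i hi a ha =>
      supported_mono (fun p hp => lt_of_le_of_lt hp hi) (hΘ i a ha)
  have h4 : Θ (∑ p ∈ c.support, c p • u p : filt lam kap d) =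
      ∑ p ∈ c.support, c p • if p.1.length = d then word k p.1 p.2 else 0 := by
    rw [Submodule.coe_sum, map_sum]
    refine Finset.sum_congr rfl fun p hp => ?_
    rw [Submodule.coe_smul, map_smul]
    congr 1
    by_cases h : p.1.length = d
    · simp only [u, dif_pos h, if_pos h]
      exact hmon p.1 p.2 ((mem_supported _ _).1 hc hp)
    · simp only [u, dif_neg h, if_neg h, Submodule.coe_zero, map_zero]
  -- The combination lies in lower levels, so its image under `Θ` involves only words shorter than
  -- `d`, yet `p₀` occurs in it.
  have h5 := h3 h2
  rw [Submodule.mem_comap, h4] at h5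
  refine absurd ((mem_supported _ _).1 h5 (?_ : p₀ ∈ _)) (lt_irrefl d)
  classical
  rw [Finset.mem_coe, Finsupp.mem_support_iff, Finsupp.finsetSum_apply,
    Finset.sum_eq_single_of_mem p₀ (Finsupp.mem_support_iff.2 hp₀)]
  · simpa [hd, word] using hp₀
  · intro p _ hp
    split_ifs
    · simp [word, hp]
    · simp

end Spanning

/-! ### The H-module T(V) ⊗ kG modulo relations -/

section Action

variable {n : ℕ} (b : Module.Basis (Fin n) k V)
  {lam : MonoidAlgebra k G →ₗ[k] V →ₗ[k] MonoidAlgebra k G}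
  {kap : V →ₗ[k] V →ₗ[k] MonoidAlgebra k G} [Fintype G] [SMulCommClass G k V]
  (h1 : ∀ (g h : G) (v : V), lam (of k G (g * h)) v =
    lam (of k G g) (h • v) * of k G h + of k G g * lam (of k G h) v)
  (h2 : ∀ (g : G) (u v : V), kap (g • u) (g • v) * of k G g - of k G g * kap u v =
    lam (lam (of k G g) v) u - lam (lam (of k G g) u) v)
  (h3 : ∀ (g h : G) (u v : V), (lam (of k G g) v).coeff h • (h • u - g • u) =
    (lam (of k G g) u).coeff h • (h • v - g • v))

variable (lam kap) in
/-- The submodule of relations of `H_{λ,κ}` in `T(V) ⊗ kG`. -/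
noncomputable def relSubmodule : Submodule k (WordModule k G (Fin n)) := ⨆ d, relLE b lam kap d

omit [Fintype G] [SMulCommClass G k V] in
theorem relSubmodule_le_comap_vecOp (v : V) :
    relSubmodule b lam kap ≤ (relSubmodule b lam kap).comap (vecOp b G v) :=
  iSup_le fun d _ hm => Submodule.mem_iSup_of_mem (d + 1) (vecOp_mem_relLE b lam kap v hm)

include h1 h2 h3 in
theorem relSubmodule_le_comap_algOp (x : MonoidAlgebra k G) :
    relSubmodule b lam kap ≤ (relSubmodule b lam kap).comap (algOp b lam x) :=
  iSup_le fun d _ hm => Submodule.mem_iSup_of_mem d (algOp_mem_relLE b h1 h2 h3 x hm)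

/-- The action of the generators of `H_{λ,κ}` on the quotient of `T(V) ⊗ kG` by the relations. -/
noncomputable def genAction :
    FreeAlgebra k (V ⊕ G) →ₐ[k] Module.End k (WordModule k G (Fin n) ⧸ relSubmodule b lam kap) :=
  FreeAlgebra.lift k <| Sum.elim
    (fun v => (relSubmodule b lam kap).mapQ _ (vecOp b G v) (relSubmodule_le_comap_vecOp b v))
    (fun g => (relSubmodule b lam kap).mapQ _ (algOp b lam (of k G g))
      (relSubmodule_le_comap_algOp b h1 h2 h3 _))

theorem genAction_vec (v : V) (m : WordModule k G (Fin n)) :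
    genAction b h1 h2 h3 (vec k G v) (Submodule.Quotient.mk m) =
      Submodule.Quotient.mk (vecOp b G v m) := by
  rw [genAction, vec, FreeAlgebra.lift_ι_apply]
  rfl

theorem genAction_grp (g : G) (m : WordModule k G (Fin n)) :
    genAction b h1 h2 h3 (grp k V g) (Submodule.Quotient.mk m) =
      Submodule.Quotient.mk (algOp b lam (of k G g) m) := by
  rw [genAction, grp, FreeAlgebra.lift_ι_apply]
  rfl

theorem genAction_grpAlg (x : MonoidAlgebra k G) (m : WordModule k G (Fin n)) :
    genAction b h1 h2 h3 (grpAlg V x) (Submodule.Quotient.mk m) =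
      Submodule.Quotient.mk (algOp b lam x m) := by
  change _ = (relSubmodule b lam kap).mkQ _
  rw [grpAlg, algOp_apply, map_finsuppSum, Finsupp.sum, Finsupp.sum, LinearMap.sum_apply,
    LinearMap.sum_apply, map_sum]
  refine Finset.sum_congr rfl fun g _ => ?_
  rw [map_smul, LinearMap.smul_apply, genAction_grp, LinearMap.smul_apply, map_smul, algOp_of]
  rfl

/-- The group relations come from condition 1. The cross relation already holds on T(V) ⊗ kG, while
the commutator relation holds only in the quotient. -/
theorem genAction_rel {x y : FreeAlgebra k (V ⊕ G)} (h : Rel lam kap x y) :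
    genAction b h1 h2 h3 x = genAction b h1 h2 h3 y := by
  refine LinearMap.ext fun q => ?_
  obtain ⟨m, rfl⟩ := Submodule.Quotient.mk_surjective _ q
  cases h with
  | vec_add v w => simp only [map_add, LinearMap.add_apply, genAction_vec, Submodule.Quotient.mk_add]
  | vec_smul c v =>
    simp only [map_smul, LinearMap.smul_apply, genAction_vec, Submodule.Quotient.mk_smul]
  | grp_one =>
    rw [genAction_grp, algOp_of, grpOp_one b h1, map_one]
    rfl
  | grp_mul g h =>
    rw [map_mul, Module.End.mul_apply, genAction_grp, genAction_grp, genAction_grp, algOp_of,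
      algOp_of, algOp_of, ← grpOp_mul_grpOp b h1]
    rfl
  | comm v w =>
    simp only [map_sub, map_mul, LinearMap.sub_apply, Module.End.mul_apply, genAction_vec,
      genAction_grpAlg]
    rw [← Submodule.Quotient.mk_sub, Submodule.Quotient.eq]
    -- Finite support bounds the word lengths in `m`, as membership in some `relLE` requires.
    obtain ⟨d, hd⟩ : ∃ d, m ∈ wordLE k G (Fin n) d :=
      ⟨m.support.sup fun p => p.1.length, fun p hp =>
        Finset.le_sup (f := fun p : List (Fin n) × G => p.1.length) hp⟩
    exact Submodule.mem_iSup_of_mem (2 + d)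
      (prefixOp_commRel_mem_relLE b lam kap (a := []) (u := v) (v := w) hd (by simp))
  | cross g v =>
    simp only [map_sub, map_mul, LinearMap.sub_apply, Module.End.mul_apply, genAction_vec,
      genAction_grp, genAction_grpAlg]
    rw [← Submodule.Quotient.mk_sub]
    congr 1
    rw [sub_eq_iff_eq_add']
    exact LinearMap.congr_fun (algOp_mul_vecOp b lam g v) m

/-- The action of `H_{λ,κ}` on the quotient of `T(V) ⊗ kG` by the relations. -/
noncomputable def action :
    Hecke lam kap →ₐ[k] Module.End k (WordModule k G (Fin n) ⧸ relSubmodule b lam kap) :=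
  RingQuot.liftAlgHom k ⟨genAction b h1 h2 h3, fun _ _ h => genAction_rel b h1 h2 h3 h⟩

theorem action_gen_inl (v : V) (m : WordModule k G (Fin n)) :
    action b h1 h2 h3 (gen lam kap (Sum.inl v)) (Submodule.Quotient.mk m) =
      Submodule.Quotient.mk (vecOp b G v m) := by
  rw [action, gen, RingQuot.liftAlgHom_mkAlgHom_apply]
  exact genAction_vec b h1 h2 h3 v m

theorem action_gen_inr (g : G) (m : WordModule k G (Fin n)) :
    action b h1 h2 h3 (gen lam kap (Sum.inr g)) (Submodule.Quotient.mk m) =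
      Submodule.Quotient.mk (algOp b lam (of k G g) m) := by
  rw [action, gen, RingQuot.liftAlgHom_mkAlgHom_apply]
  exact genAction_grp b h1 h2 h3 g m

theorem action_mem_of_mem_filt {d : ℕ} {a : Hecke lam kap} (ha : a ∈ filt lam kap d) :
    action b h1 h2 h3 a (Submodule.Quotient.mk (word k [] 1)) ∈
      (wordLE k G (Fin n) d).map (relSubmodule b lam kap).mkQ := by
  suffices h : filt lam kap d ≤ ((wordLE k G (Fin n) d).map (relSubmodule b lam kap).mkQ).comap
      ((LinearMap.applyₗ (Submodule.Quotient.mk (word k [] 1))) ∘ₗ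
        (action b h1 h2 h3).toLinearMap) from h ha
  refine Submodule.span_le.2 ?_
  rintro _ ⟨l, hl, rfl⟩
  change action b h1 h2 h3 _ _ ∈ Submodule.map _ _
  refine Submodule.map_mono (wordLE_mono hl) ?_
  clear hl
  induction l with
  | nil =>
    rw [List.map_nil, List.prod_nil, map_one]
    exact ⟨word k [] 1, word_mem_wordLE (by simp), rfl⟩
  | cons s l ih =>
    obtain ⟨m, hm, hm'⟩ := ih
    rw [List.map_cons, List.prod_cons, map_mul, Module.End.mul_apply, ← hm', Submodule.mkQ_apply]
    cases s with
    | inl v =>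
      rw [action_gen_inl, List.countP_cons_of_pos (by rfl)]
      exact ⟨_, vecOp_mem_wordLE b v hm, rfl⟩
    | inr g =>
      rw [action_gen_inr, List.countP_cons_of_neg (by simp)]
      exact ⟨_, algOp_mem_wordLE b lam _ hm, rfl⟩

/-- Letters are prepended one at a time to the empty word carrying g, so no reordering takes place.
-/
theorem action_monomial (l : List (Fin n)) (g : G) :
    action b h1 h2 h3 (monomial b lam kap (l, g)) (Submodule.Quotient.mk (word k [] 1)) =
      Submodule.Quotient.mk (word k l g) := by
  rw [monomial, monomialGens]
  induction l with
  | nil =>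
    simp only [List.map_nil, List.nil_append, List.map_cons, List.prod_cons, List.prod_nil,
      mul_one]
    rw [action_gen_inr, algOp_of, grpOp_word, grpWord, mul_one]
  | cons i l ih =>
    simp only [List.map_cons, List.cons_append, List.prod_cons, map_mul,
      Module.End.mul_apply] at ih ⊢
    rw [ih, action_gen_inl, vecOp_basis_word]

end Action

/-- The filtered map required by `skewToGr_injective` is a ↦ N(a · 1), where N is the normal form
and 1 is the class of the empty word with trivial group element. -/
theorem pbw_of_conditions [Fintype G] [FiniteDimensional k V] [SMulCommClass G k V]
    {lam : MonoidAlgebra k G →ₗ[k] V →ₗ[k] MonoidAlgebra k G}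
    {kap : V →ₗ[k] V →ₗ[k] MonoidAlgebra k G} (hkap : ∀ v, kap v v = 0)
    (h1 : ∀ (g h : G) (v : V), lam (of k G (g * h)) v =
      lam (of k G g) (h • v) * of k G h + of k G g * lam (of k G h) v)
    (h2 : ∀ (g : G) (u v : V), kap (g • u) (g • v) * of k G g - of k G g * kap u v =
      lam (lam (of k G g) v) u - lam (lam (of k G g) u) v)
    (h3 : ∀ (g h : G) (u v : V), (lam (of k G g) v).coeff h • (h • u - g • u) =
      (lam (of k G g) u).coeff h • (h • v - g • v))
    (h4 : ∀ (g : G) (u v w : V), (kap u v).coeff g • (g • w - w) +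
      (kap v w).coeff g • (g • u - u) + (kap w u).coeff g • (g • v - v) = 0)
    (h5 : ∀ u v w : V, lam (kap u v) w + lam (kap v w) u + lam (kap w u) v = 0) :
    PBW lam kap := by
  let b := Module.finBasis k V
  obtain ⟨N, hN, hword, hlen⟩ := exists_normalForm b hkap h1 h2 h3 h4 h5
  -- The normal form descends to the quotient because it kills the relations of every degree.
  let N' := (relSubmodule b lam kap).liftQ N (iSup_le hN)
  let Θ : Hecke lam kap →ₗ[k] WordModule k G (Fin (Module.finrank k V)) :=
    N' ∘ₗ LinearMap.applyₗ (Submodule.Quotient.mk (word k [] 1)) ∘ₗ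
      (action b h1 h2 h3).toLinearMap
  refine pbw_of_injective lam kap (skewToGr_injective b lam kap Θ (fun d a ha => ?_) ?_)
  · obtain ⟨m, hm, hm'⟩ := action_mem_of_mem_filt b h1 h2 h3 ha
    change N' (action b h1 h2 h3 a (Submodule.Quotient.mk (word k [] 1))) ∈ _
    rw [← hm']
    exact hlen d m hm
  · intro l g hl
    change N' (action b h1 h2 h3 _ (Submodule.Quotient.mk (word k [] 1))) = _
    rw [action_monomial]
    exact hword l g hl

end Hecke

theorem mainTheorem1 {k G V : Type*} [Field k] [Group G] [Finite G] [AddCommGroup V] [Module k V]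
    [FiniteDimensional k V] [DistribMulAction G V] [SMulCommClass G k V]
    (lam : MonoidAlgebra k G →ₗ[k] V →ₗ[k] MonoidAlgebra k G)
    (kap : V →ₗ[k] V →ₗ[k] MonoidAlgebra k G) (hkap : ∀ v : V, kap v v = 0) :
    Hecke.PBW lam kap ↔
      (∀ (g h : G) (v : V),
        lam (MonoidAlgebra.of k G (g * h)) v =
          lam (MonoidAlgebra.of k G g) (h • v) * MonoidAlgebra.of k G h +
            MonoidAlgebra.of k G g * lam (MonoidAlgebra.of k G h) v) ∧
      (∀ (g : G) (u v : V),
        kap (g • u) (g • v) * MonoidAlgebra.of k G g - MonoidAlgebra.of k G g * kap u v =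
          lam (lam (MonoidAlgebra.of k G g) v) u - lam (lam (MonoidAlgebra.of k G g) u) v) ∧
      (∀ (g h : G) (u v : V),
        (lam (MonoidAlgebra.of k G g) v).coeff h • (h • u - g • u) =
          (lam (MonoidAlgebra.of k G g) u).coeff h • (h • v - g • v)) ∧
      (∀ (g : G) (u v w : V),
        (kap u v).coeff g • (g • w - w) + (kap v w).coeff g • (g • u - u) +
          (kap w u).coeff g • (g • v - v) = 0) ∧
      (∀ u v w : V,
        lam (kap u v) w + lam (kap v w) u + lam (kap w u) v = 0) := by
  have := Fintype.ofFinite G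
  exact ⟨Hecke.PBW.conditions, fun ⟨h1, h2, h3, h4, h5⟩ =>
    Hecke.pbw_of_conditions hkap h1 h2 h3 h4 h5⟩
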